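/- Let $n,m\ge 0$, let $(M,\langle\cdot,\cdot\rangle)$ be a smooth Riemannian manifold of dimension $n+m$ with Levi-Civita connection $\nabla^M$, and let $\Omega$ be a smooth $n$-form on $M$ that is parallel, i.e. $\nabla^M\Omega=0$. Let $\Sigma$ be a smooth $n$-dimensional manifold, $J\subseteq\mathbb R$ an interval with more than one point, and $F_t:\Sigma\to M$, $t\in J$, a smooth family of immersions (smooth in $(t,x)\in J\times\Sigma$) evolving by the mean curvature flow $$\frac{\partial F_t}{\partial t}=H_t,$$ where $H_t$ is the mean curvature vector of $F_t$, that is, the trace, with respect to the induced metric, of its second fundamental form $A(X,Y)=(\nabla^M_XY)^\perp$. Let $e_1,\dots,e_n$ be a smooth time-dependent tangent frame on $\Sigma$, defined for $t\in J$ and $(t,x)$ in an open set $U\subseteq\mathbb R\times\Sigma$, which is orthonormal for the metric induced by $F_t$; its image under $dF_t$ is denoted by the same letters, and $$\Omega_{1\cdots n}(t,x)=\Omega_{F_t(x)}(e_1,\dots,e_n).$$ Let $t\in J$ and $(t,x)\in U$, and let $e_{n+1},\dots,e_{n+m}$ be any orthonormal basis of the normal space of $F_t$ at $x$. Write $h_{\alpha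 ik}=\langle A(e_i,e_k),e_\alpha\rangle$, write $\Omega_{\cdots\alpha\cdots}$ and $\Omega_{\cdots\alpha\cdots\beta\cdots}$ for the value of $\Omega$ on $(e_1,\dots,e_n)$ with the indicated entries replaced by normal vectors, and let $$R_{ABCD}=\langle\nabla_{e_A}\nabla_{e_B}e_D-\nabla_{e_B}\nabla_{e_A}e_D-\nabla_{[e_A,e_B]}e_D,\;e_C\rangle$$ be the curvature tensor of $M$ (so that $R_{ABAB}$ is a sectional curvature). Then at $(t,x)$, with indices $i,k,p,q\in\{1,\dots,n\}$ and $\alpha,\beta\in\{n+1,\dots,n+m\}$, the function $\Omega_{1\cdots n}$ is differentiable in time (at fixed $x$; one-sidedly if $t$ is an endpoint of $J$) and $$\frac{d}{dt}\Omega_{1\cdots n}=\Delta\Omega_{1\cdots n}+\Omega_{1\cdots n}\sum_{\alpha,i,k}h_{\alpha ik}^2-2\sum_{p<q}\ \sum_{\alpha,\beta,k}\Omega_{1\cdots\underset{(p)}{\alpha}\cdots\underset{(q)}{\beta}\cdots n}\,h_{\alpha pk}h_{\beta qk}-\sum_{i}\ \sum_{\alpha,k}\Omega_{1\cdots\underset{(i)}{\alpha}\cdots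 n}\,R_{\alpha kki},$$ where $\Delta$ is the Laplacian on functions of the metric induced by $F_t$ on $\Sigma$, and $(p)$, $(q)$, $(i)$ mark the position of the replaced entry. -/

import Mathlib

open scoped Manifold ContDiff

namespace MCF

noncomputable section

/-! ### Riemannian geometry in a chart

`G : E → E →L[ℝ] E →L[ℝ] ℝ` is the coordinate expression of a Riemannian metric on a model space. -/

section Coordinates

variable {E : Type*} [NormedAddCommGroup E] [NormedSpace ℝ E]

/-- The linear form `u ↦ (D_v G (w, u) + D_w G (v, u) - D_u G (v, w)) / 2`
(Christoffel symbols of the first kind). -/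
def christoffelForm (G : E → E →L[ℝ] E →L[ℝ] ℝ) (z v w : E) : E →L[ℝ] ℝ :=
  (1 / 2 : ℝ) • (fderiv ℝ G z v w + fderiv ℝ G z w v - ((fderiv ℝ G z).flip v).flip w)

/-- Christoffel symbols of the Levi-Civita connection: `christoffel G z v w` is the vector with
components `Γ^k_{ij} v^i w^j` at `z`, obtained from `christoffelForm` by raising the index with the
inverse of `G z`. -/
def christoffel (G : E → E →L[ℝ] E →L[ℝ] ℝ) (z v w : E) : E :=
  (G z).inverse (christoffelForm G z v w)

/-- The curvature operator `R(u, v) w = ∇_u ∇_v w - ∇_v ∇_u w - ∇_[u, v] w` in coordinates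
(for constant coordinate fields the bracket vanishes). -/
def curvatureCoord (G : E → E →L[ℝ] E →L[ℝ] ℝ) (z u v w : E) : E :=
  fderiv ℝ (fun y ↦ christoffel G y v w) z u - fderiv ℝ (fun y ↦ christoffel G y u w) z v
    + christoffel G z u (christoffel G z v w) - christoffel G z v (christoffel G z u w)

variable {n : ℕ} {W : Type*} [AddCommGroup W] [Module ℝ W]

/-- The `i`-th coordinate vector of `ℝⁿ`. -/
def coordVec (i : Fin n) : EuclideanSpace ℝ (Fin n) := EuclideanSpace.single i 1

/-- The trace `Λ^{ij} B(∂_i, ∂_j)` of `B` with respect to the inner product `Λ` on `ℝⁿ`. -/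
def metricTrace (Λ : EuclideanSpace ℝ (Fin n) →L[ℝ] EuclideanSpace ℝ (Fin n) →L[ℝ] ℝ)
    (B : EuclideanSpace ℝ (Fin n) → EuclideanSpace ℝ (Fin n) → W) : W :=
  ∑ i, ∑ j, (Matrix.of fun a b : Fin n ↦ Λ (coordVec a) (coordVec b))⁻¹ i j •
    B (coordVec i) (coordVec j)

/-- The Laplace-Beltrami operator `Λ^{ij} (∂_i ∂_j u - Γ^k_{ij} ∂_k u)` of the metric `Λ`. -/
def laplacianCoord
    (Λ : EuclideanSpace ℝ (Fin n) → EuclideanSpace ℝ (Fin n) →L[ℝ] EuclideanSpace ℝ (Fin n) →L[ℝ] ℝ)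
    (u : EuclideanSpace ℝ (Fin n) → ℝ) (z : EuclideanSpace ℝ (Fin n)) : ℝ :=
  metricTrace (Λ z) fun v w ↦ fderiv ℝ (fderiv ℝ u) z v w - fderiv ℝ u z (christoffel Λ z v w)

/-- The metric induced by a map `f`: `Λ_{ij} = ⟨∂_i f, ∂_j f⟩`. -/
def inducedMetric (G : E → E →L[ℝ] E →L[ℝ] ℝ) (f : EuclideanSpace ℝ (Fin n) → E)
    (z : EuclideanSpace ℝ (Fin n)) :
    EuclideanSpace ℝ (Fin n) →L[ℝ] EuclideanSpace ℝ (Fin n) →L[ℝ] ℝ :=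
  (G (f z)).bilinearComp (fderiv ℝ f z) (fderiv ℝ f z)

/-- The component of `X` normal to the immersion `f` at `z`:
`X - Λ^{ij} ⟨X, ∂_i f⟩ ∂_j f`. -/
def normalPart (G : E → E →L[ℝ] E →L[ℝ] ℝ) (f : EuclideanSpace ℝ (Fin n) → E)
    (z : EuclideanSpace ℝ (Fin n)) (X : E) : E :=
  X - metricTrace (inducedMetric G f z) fun v w ↦ G (f z) X (fderiv ℝ f z v) • fderiv ℝ f z w

/-- The second fundamental form `A(v, w) = (∇_v ∂_w f)^⊥` of the immersion `f`, where
`∇_v ∂_w f = D²f(v, w) + Γ(∂_v f, ∂_w f)`. -/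
def secondFundCoord (G : E → E →L[ℝ] E →L[ℝ] ℝ) (f : EuclideanSpace ℝ (Fin n) → E)
    (z v w : EuclideanSpace ℝ (Fin n)) : E :=
  normalPart G f z (fderiv ℝ (fderiv ℝ f) z v w
    + christoffel G (f z) (fderiv ℝ f z v) (fderiv ℝ f z w))

/-- The mean curvature vector `H = Λ^{ij} (∇_{∂_i} ∂_j f)^⊥`. -/
def meanCurvCoord (G : E → E →L[ℝ] E →L[ℝ] ℝ) (f : EuclideanSpace ℝ (Fin n) → E)
    (z : EuclideanSpace ℝ (Fin n)) : E :=
  metricTrace (inducedMetric G f z) (secondFundCoord G f z)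

end Coordinates

/-! ### Riemannian geometry on manifolds, computed in charts

All the notions below are tensorial, that is, their values do not depend on the charts
`φ` (of the ambient manifold) and `ψ` (of the submanifold) in which they are computed. -/

section Manifolds

variable {d : ℕ} {M : Type*} [TopologicalSpace M] [ChartedSpace (EuclideanSpace ℝ (Fin d)) M]
  [IsManifold (𝓡 d) ∞ M]

/-- Smooth Riemannian metrics on `M`. -/
abbrev Metric (d : ℕ) (M : Type*) [TopologicalSpace M]
    [ChartedSpace (EuclideanSpace ℝ (Fin d)) M] [IsManifold (𝓡 d) ∞ M] : Type _ :=
  Bundle.ContMDiffRiemannianMetric (𝓡 d) ∞ (EuclideanSpace ℝ (Fin d))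
    (fun x : M ↦ TangentSpace (𝓡 d) x)

/-- The differential at `y` of the chart `φ`. -/
def toChart (φ : OpenPartialHomeomorph M (EuclideanSpace ℝ (Fin d))) (y : M) :
    TangentSpace (𝓡 d) y →L[ℝ] EuclideanSpace ℝ (Fin d) :=
  mfderiv (𝓡 d) (𝓡 d) φ y

/-- The differential at `z` of the inverse of the chart `φ`. -/
def ofChart (φ : OpenPartialHomeomorph M (EuclideanSpace ℝ (Fin d)))
    (z : EuclideanSpace ℝ (Fin d)) :
    EuclideanSpace ℝ (Fin d) →L[ℝ] TangentSpace (𝓡 d) (φ.symm z) :=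
  mfderiv (𝓡 d) (𝓡 d) φ.symm z

/-- The coordinate expression of a Riemannian metric in the chart `φ`. -/
def metricInChart (g : Metric d M) (φ : OpenPartialHomeomorph M (EuclideanSpace ℝ (Fin d)))
    (z : EuclideanSpace ℝ (Fin d)) :
    EuclideanSpace ℝ (Fin d) →L[ℝ] EuclideanSpace ℝ (Fin d) →L[ℝ] ℝ :=
  ContinuousLinearMap.bilinearComp
    (show EuclideanSpace ℝ (Fin d) →L[ℝ] EuclideanSpace ℝ (Fin d) →L[ℝ] ℝ from g.inner (φ.symm z))
    (ofChart φ z) (ofChart φ z)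

lemma metricInChart_apply (g : Metric d M)
    (φ : OpenPartialHomeomorph M (EuclideanSpace ℝ (Fin d))) (z v w : EuclideanSpace ℝ (Fin d)) :
    metricInChart g φ z v w = g.inner (φ.symm z) (ofChart φ z v) (ofChart φ z w) := rfl

/-- The curvature tensor at `y`, computed in the chart `φ`, with the convention
`R(X, Y, Z, W) = ⟨∇_X ∇_Y W - ∇_Y ∇_X W - ∇_[X, Y] W, Z⟩`; thus `R(X, Y, X, Y)` is the sectional
curvature of the plane spanned by the orthonormal vectors `X`, `Y`. -/
def curvature (g : Metric d M) (φ : OpenPartialHomeomorph M (EuclideanSpace ℝ (Fin d)))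
    (y : M) (X Y Z W : TangentSpace (𝓡 d) y) : ℝ :=
  metricInChart g φ (φ y)
    (curvatureCoord (metricInChart g φ) (φ y) (toChart φ y X) (toChart φ y Y) (toChart φ y W))
    (toChart φ y Z)

variable {n : ℕ}

/-- The coordinate expression of an `n`-form in the chart `φ`. -/
def formInChart (Ω : ∀ y : M, TangentSpace (𝓡 d) y [⋀^Fin n]→L[ℝ] ℝ)
    (φ : OpenPartialHomeomorph M (EuclideanSpace ℝ (Fin d))) (z : EuclideanSpace ℝ (Fin d)) :
    EuclideanSpace ℝ (Fin d) [⋀^Fin n]→L[ℝ] ℝ :=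
  (Ω (φ.symm z)).compContinuousLinearMap (ofChart φ z)

/-- `Ω` is a smooth differential form. -/
def IsSmoothForm (Ω : ∀ y : M, TangentSpace (𝓡 d) y [⋀^Fin n]→L[ℝ] ℝ) : Prop :=
  ∀ φ ∈ IsManifold.maximalAtlas (𝓡 d) ∞ M, ContDiffOn ℝ ∞ (formInChart Ω φ) φ.target

/-- `Ω` is parallel for the Levi-Civita connection of `g`: in every chart
`(∇_v Ω)(w₁, …, wₙ) = v(Ω(w₁, …, wₙ)) - ∑ᵢ Ω(w₁, …, Γ(v, wᵢ), …, wₙ)` vanishes. -/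
def IsParallelForm (g : Metric d M) (Ω : ∀ y : M, TangentSpace (𝓡 d) y [⋀^Fin n]→L[ℝ] ℝ) :
    Prop :=
  ∀ φ ∈ IsManifold.maximalAtlas (𝓡 d) ∞ M, ∀ z ∈ φ.target,
    ∀ (v : EuclideanSpace ℝ (Fin d)) (w : Fin n → EuclideanSpace ℝ (Fin d)),
      fderiv ℝ (formInChart Ω φ) z v w
        - ∑ i, formInChart Ω φ z (Function.update w i (christoffel (metricInChart g φ) z v (w i)))
      = 0

variable {N : Type*} [TopologicalSpace N] [ChartedSpace (EuclideanSpace ℝ (Fin n)) N]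

/-- The coordinate expression `φ ∘ f ∘ ψ⁻¹` of a map `f : N → M`. -/
def mapInCharts (φ : OpenPartialHomeomorph M (EuclideanSpace ℝ (Fin d)))
    (ψ : OpenPartialHomeomorph N (EuclideanSpace ℝ (Fin n))) (f : N → M) :
    EuclideanSpace ℝ (Fin n) → EuclideanSpace ℝ (Fin d) :=
  fun z ↦ φ (f (ψ.symm z))

/-- The component `h_ν(v, w) = ⟨A(v, w), ν⟩` of the second fundamental form of the immersion
`f : N → M` at `x`, where `v`, `w` are tangent to `N` at `x` and `ν` is tangent to `M` at `f x`,
computed in the charts `φ`, `ψ`. -/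
def secondFund (g : Metric d M) (φ : OpenPartialHomeomorph M (EuclideanSpace ℝ (Fin d)))
    (ψ : OpenPartialHomeomorph N (EuclideanSpace ℝ (Fin n))) (f : N → M) (x : N)
    (v w : TangentSpace (𝓡 n) x) (ν : TangentSpace (𝓡 d) (f x)) : ℝ :=
  metricInChart g φ (φ (f x))
    (secondFundCoord (metricInChart g φ) (mapInCharts φ ψ f) (ψ x) (toChart ψ x v) (toChart ψ x w))
    (toChart φ (f x) ν)

/-- The Laplacian at `x` of a function `u` on `N`, for the metric induced by the immersion
`f : N → M`, computed in the charts `φ`, `ψ`. -/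
def laplacian (g : Metric d M) (φ : OpenPartialHomeomorph M (EuclideanSpace ℝ (Fin d)))
    (ψ : OpenPartialHomeomorph N (EuclideanSpace ℝ (Fin n))) (f : N → M) (u : N → ℝ) (x : N) : ℝ :=
  laplacianCoord (inducedMetric (metricInChart g φ) (mapInCharts φ ψ f)) (fun z ↦ u (ψ.symm z)) (ψ x)

/-- `F t`, `t ∈ J`, is a smooth family of immersions `N → M` moving by the mean curvature vector,
`∂F/∂t = H`. The equation is between tangent vectors of `M`, and is written out in charts. At an
endpoint of `J` the time derivative is one-sided. -/
structure IsMeanCurvatureFlow (n : ℕ) {N : Type*} [TopologicalSpace N]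
    [ChartedSpace (EuclideanSpace ℝ (Fin n)) N] (g : Metric d M) (J : Set ℝ) (F : ℝ → N → M) : Prop where
  smooth : ContMDiffOn (𝓘(ℝ, ℝ).prod (𝓡 n)) (𝓡 d) ∞ (fun p : ℝ × N ↦ F p.1 p.2)
    (J ×ˢ Set.univ)
  immersion : ∀ t ∈ J, ∀ x, Function.Injective (mfderiv (𝓡 n) (𝓡 d) (F t) x)
  velocity : ∀ φ ∈ IsManifold.maximalAtlas (𝓡 d) ∞ M, ∀ ψ ∈ IsManifold.maximalAtlas (𝓡 n) ∞ N,
    ∀ t ∈ J, ∀ x ∈ ψ.source, F t x ∈ φ.source →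
      HasDerivWithinAt (fun s ↦ φ (F s x))
        (meanCurvCoord (metricInChart g φ) (mapInCharts φ ψ (F t)) (ψ x)) J t

/-- The images `dF_t(e_1), …, dF_t(e_n)` in `T M` of a time-dependent frame on `N`. -/
def pushFrame (d : ℕ) {M : Type*} [TopologicalSpace M]
    [ChartedSpace (EuclideanSpace ℝ (Fin d)) M] (F : ℝ → N → M) (e : Fin n → ℝ → ∀ x : N, TangentSpace (𝓡 n) x) (t : ℝ) (x : N)
    (i : Fin n) : TangentSpace (𝓡 d) (F t x) :=
  mfderiv (𝓡 n) (𝓡 d) (F t) x (e i t x)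

/-- `e_1, …, e_n` is a smooth time-dependent tangent frame, defined for `(t, x)` in `U` with `t` in
`J`, which is orthonormal for the metric induced by `F t`. -/
structure IsOrthonormalFrame [IsManifold (𝓡 n) ∞ N] (g : Metric d M) (J : Set ℝ) (F : ℝ → N → M) (U : Set (ℝ × N))
    (e : Fin n → ℝ → ∀ x : N, TangentSpace (𝓡 n) x) : Prop where
  smooth : ∀ i, ContMDiffOn (𝓘(ℝ, ℝ).prod (𝓡 n)) (𝓡 n).tangent ∞
    (fun p : ℝ × N ↦ (⟨p.2, e i p.1 p.2⟩ : TangentBundle (𝓡 n) N)) (U ∩ J ×ˢ Set.univ)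
  orthonormal : ∀ t ∈ J, ∀ x, (t, x) ∈ U → ∀ i j,
    g.inner (F t x) (pushFrame d F e t x i) (pushFrame d F e t x j) = if i = j then 1 else 0

end Manifolds

end

end MCF

namespace MCF

noncomputable section

open Filter Topology Function

set_option maxSynthPendingDepth 3
set_option linter.unusedSectionVars false

/-! The computation takes place in one pair of charts, with `cov` as covariant derivative along the
map and with the given orthonormal frame X_i = dF(e_i); no normal coordinates or adapted frames are
chosen. Since Ω is parallel, differentiating Ω(X_1, …, X_n) only differentiates the entries. A
vector put in slot i counts only through its normal part and its component along X_i, because any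
other X_k would be a repeated entry.

In time, torsion-freeness gives ∇_t X_i = ∇_{e_i} H + dF(∂_t e_i), and |X_i| = 1 kills the component
along X_i. So the time derivative is the sum over i of Ω with (∇_{e_i} H)^⊥ in slot i
(`hasDerivWithinAt_form_of_velocity`).

In space, ∇_w X_i = A(w, e_i) + ∑ c_ik X_k, where c is skew. After two derivatives all terms
containing c cancel (`sum_update_update_of_skew`, `fderiv_fderiv_form`). The Laplacian is then -|A|²
Ω, plus the terms with two entries replaced by values of A, plus terms with the normal part of a
traced third derivative of F in one slot (`laplacianCoord_form`).

The normal derivative of H is also a traced third derivative of F, with the differentiations in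
another order (`nor_cov_meanCurvCoord`). Commuting them costs one ambient curvature term
(`covHess_sub`), which is the Codazzi equation, and `sum_cov_meanCurvCoord` combines these facts
into the right-hand side. What remains is to exchange time and space derivatives up to an endpoint
of J (`hasDerivWithinAt_fderiv_apply`) and to read the manifold data in charts. -/

lemma two_le_infty : (2 : WithTop ℕ∞) ≤ ∞ := 
  WithTop.coe_le_coe.2 (le_top : (2 : ℕ∞) ≤ ⊤)

/-! ### Levi-Civita connection and curvature of a metric on an open set of a vector space -/

section LeviCivita

variable {E : Type*} [NormedAddCommGroup E] [NormedSpace ℝ E]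

/-- `G` is a smooth Riemannian metric on the open set `O`. -/
structure IsRiemannianOn (G : E → E →L[ℝ] E →L[ℝ] ℝ) (O : Set E) : Prop where
  isOpen : IsOpen O
  contDiffOn : ContDiffOn ℝ ∞ G O
  symm : ∀ p ∈ O, ∀ v w, G p v w = G p w v
  pos : ∀ p ∈ O, ∀ v, v ≠ 0 → 0 < G p v v

/-- The Christoffel symbols of the first kind as a function of the derivative of the metric. -/
def lowerChristoffel (T : E →L[ℝ] E →L[ℝ] E →L[ℝ] ℝ) : E →L[ℝ] E →L[ℝ] E →L[ℝ] ℝ :=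
  (1 / 2 : ℝ) • (T + T.flip -
    ((ContinuousLinearMap.flipₗᵢ ℝ E E ℝ).toContinuousLinearEquiv :
      (E →L[ℝ] E →L[ℝ] ℝ) →L[ℝ] (E →L[ℝ] E →L[ℝ] ℝ)).comp T.flip)

lemma lowerChristoffel_apply (T : E →L[ℝ] E →L[ℝ] E →L[ℝ] ℝ) (v w u : E) :
    lowerChristoffel T v w u = (1 / 2 : ℝ) * (T v w u + T w v u - T u v w) := by
  simp [lowerChristoffel]

lemma christoffelForm_eq (G : E → E →L[ℝ] E →L[ℝ] ℝ) (z v w : E) :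
    christoffelForm G z v w = lowerChristoffel (fderiv ℝ G z) v w := by
  ext u
  simp [christoffelForm, lowerChristoffel_apply]

lemma contDiff_lowerChristoffel :
    ContDiff ℝ ∞ (lowerChristoffel : (E →L[ℝ] E →L[ℝ] E →L[ℝ] ℝ) → _) := by
  unfold lowerChristoffel
  have h : ContDiff ℝ ∞ fun T : E →L[ℝ] E →L[ℝ] E →L[ℝ] ℝ ↦ T.flip :=
    (ContinuousLinearMap.flipₗᵢ ℝ E E (E →L[ℝ] ℝ)).toContinuousLinearEquiv.contDiff
  exact ((contDiff_id.add h).sub (contDiff_const.clm_comp h)).const_smul _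

/-- The Christoffel symbols as a field of continuous bilinear maps. -/
def christoffelL (G : E → E →L[ℝ] E →L[ℝ] ℝ) (z : E) : E →L[ℝ] E →L[ℝ] E :=
  (ContinuousLinearMap.compL ℝ E (E →L[ℝ] ℝ) E (G z).inverse).comp
    (lowerChristoffel (fderiv ℝ G z))

lemma christoffelL_apply (G : E → E →L[ℝ] E →L[ℝ] ℝ) (z v w : E) :
    christoffelL G z v w = christoffel G z v w := by
  simp [christoffelL, christoffel, christoffelForm_eq]

/-- The derivative of a metric takes values in symmetric bilinear forms. -/
lemma IsRiemannianOn.fderiv_symm {G : E → E →L[ℝ] E →L[ℝ] ℝ} {O : Set E}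
    (hG : IsRiemannianOn G O) {p : E} (hp : p ∈ O) (u v w : E) :
    fderiv ℝ G p u v w = fderiv ℝ G p u w v := by
  have hd : DifferentiableAt ℝ G p :=
    (hG.contDiffOn.contDiffAt (hG.isOpen.mem_nhds hp)).differentiableAt (by simp)
  have h1 : (fun q ↦ G q v w) =ᶠ[𝓝 p] fun q ↦ G q w v := by
    filter_upwards [hG.isOpen.mem_nhds hp] with q hq using hG.symm q hq v w
  have h2 : ∀ v w, fderiv ℝ (fun q ↦ G q v w) p u = fderiv ℝ G p u v w := fun v w ↦ by
    have := ((hd.hasFDerivAt.clm_apply (hasFDerivAt_const v p)).clm_apply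
      (hasFDerivAt_const w p)).fderiv
    rw [this]
    simp
  rw [← h2, ← h2, h1.fderiv_eq]

variable [FiniteDimensional ℝ E]

/-- Positivity makes B injective, and E and its dual have the same finite dimension. This matters
because `ContinuousLinearMap.inverse` is zero on non-invertible maps: here the raised index in
`christoffel` is the genuine one. -/
lemma isInvertible_of_pos {B : E →L[ℝ] E →L[ℝ] ℝ} (hB : ∀ v, v ≠ 0 → 0 < B v v) :
    B.IsInvertible := by
  have hinj : Function.Injective (LinearMap.toContinuousLinearMap.symm.toLinearMap ∘ₗ
      B.toLinearMap : E →ₗ[ℝ] E →ₗ[ℝ] ℝ) := by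
    rw [injective_iff_map_eq_zero]
    intro v hv
    by_contra h
    have h1 := hB v h
    have h2 : B v v = 0 := LinearMap.congr_fun hv v
    linarith
  have hfin : Module.finrank ℝ E = Module.finrank ℝ (E →L[ℝ] ℝ) := by
    rw [← LinearEquiv.finrank_eq (LinearMap.toContinuousLinearMap (𝕜 := ℝ) (E := E) (F' := ℝ))]
    exact (Subspace.dual_finrank_eq (K := ℝ) (V := E)).symm
  have hinj' : Function.Injective B.toLinearMap := fun v w h ↦ hinj (by simp_all)
  exact ⟨(LinearEquiv.ofInjectiveOfFinrankEq B.toLinearMap hinj' hfin).toContinuousLinearEquiv,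
    by ext; rfl⟩

variable {G : E → E →L[ℝ] E →L[ℝ] ℝ} {O : Set E}

namespace IsRiemannianOn

lemma contDiffAt (hG : IsRiemannianOn G O) {p : E} (hp : p ∈ O) : ContDiffAt ℝ ∞ G p :=
  hG.contDiffOn.contDiffAt (hG.isOpen.mem_nhds hp)

lemma differentiableAt (hG : IsRiemannianOn G O) {p : E} (hp : p ∈ O) :
    DifferentiableAt ℝ G p :=
  (hG.contDiffAt hp).differentiableAt (by simp)

lemma contDiffAt_christoffelL (hG : IsRiemannianOn G O) {p : E} (hp : p ∈ O) :
    ContDiffAt ℝ ∞ (christoffelL G) p := by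
  have h1 : ContDiffAt ℝ ∞ (fun z ↦ (G z).inverse) p :=
    (isInvertible_of_pos (hG.pos p hp)).contDiffAt_map_inverse.comp p (hG.contDiffAt hp)
  have h2 : ContDiffAt ℝ ∞ (fun z ↦ lowerChristoffel (fderiv ℝ G z)) p :=
    contDiff_lowerChristoffel.contDiffAt.comp p ((hG.contDiffAt hp).fderiv_right (by simp))
  exact ((ContinuousLinearMap.compL ℝ E (E →L[ℝ] ℝ) E).contDiff.contDiffAt.comp p h1).clm_comp h2

lemma differentiableAt_christoffelL (hG : IsRiemannianOn G O) {p : E} (hp : p ∈ O) :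
    DifferentiableAt ℝ (christoffelL G) p :=
  (hG.contDiffAt_christoffelL hp).differentiableAt (by simp)

/-- Koszul's formula. With nondegeneracy (`eq_of_forall`) it determines the symbols, so the inverse
of the metric need not be unfolded again. -/
lemma metric_christoffelL (hG : IsRiemannianOn G O) {p : E} (hp : p ∈ O) (v w u : E) :
    G p (christoffelL G p v w) u
      = (1 / 2 : ℝ) * (fderiv ℝ G p v w u + fderiv ℝ G p w v u - fderiv ℝ G p u v w) := by
  have h : G p (christoffelL G p v w) = lowerChristoffel (fderiv ℝ G p) v w := by
    simp only [christoffelL, ContinuousLinearMap.comp_apply, ContinuousLinearMap.compL_apply]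
    exact (isInvertible_of_pos (hG.pos p hp)).self_apply_inverse _
  rw [h, lowerChristoffel_apply]

lemma eq_of_forall (hG : IsRiemannianOn G O) {p : E} (hp : p ∈ O) {v w : E}
    (h : ∀ u, G p v u = G p w u) : v = w := by
  by_contra hne
  have h1 := hG.pos p hp (v - w) (sub_ne_zero.2 hne)
  simp [h] at h1

lemma christoffelL_symm (hG : IsRiemannianOn G O) {p : E} (hp : p ∈ O) (v w : E) :
    christoffelL G p v w = christoffelL G p w v := by
  refine hG.eq_of_forall hp fun u ↦ ?_
  rw [hG.metric_christoffelL hp, hG.metric_christoffelL hp, hG.fderiv_symm hp u v w]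
  ring

/-- Metric compatibility: in the sum of two Koszul formulas all but one derivative of G cancel. -/
lemma fderiv_metric (hG : IsRiemannianOn G O) {p : E} (hp : p ∈ O) (v a b : E) :
    fderiv ℝ G p v a b = G p (christoffelL G p v a) b + G p a (christoffelL G p v b) := by
  rw [hG.symm p hp a, hG.metric_christoffelL hp, hG.metric_christoffelL hp,
    hG.fderiv_symm hp v b a, hG.fderiv_symm hp b v a, hG.fderiv_symm hp a v b]
  ring

end IsRiemannianOn

/-! ### Symmetries of the curvature -/

namespace IsRiemannianOn

lemma curvatureCoord_eq (hG : IsRiemannianOn G O) {p : E} (hp : p ∈ O) (u v w : E) :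
    curvatureCoord G p u v w
      = fderiv ℝ (christoffelL G) p u v w - fderiv ℝ (christoffelL G) p v u w
        + christoffelL G p u (christoffelL G p v w)
        - christoffelL G p v (christoffelL G p u w) := by
  have h : ∀ u v w, fderiv ℝ (fun y ↦ christoffel G y v w) p u
      = fderiv ℝ (christoffelL G) p u v w := fun u v w ↦ by
    have := ((hG.differentiableAt_christoffelL hp).hasFDerivAt.clm_apply
      (hasFDerivAt_const v p)).clm_apply (hasFDerivAt_const w p)
    simp only [christoffelL_apply] at this
    rw [this.fderiv]
    simp
  simp only [curvatureCoord, h, christoffelL_apply]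

lemma curvatureCoord_antisymm (G : E → E →L[ℝ] E →L[ℝ] ℝ) (p u v w : E) :
    curvatureCoord G p u v w = - curvatureCoord G p v u w := by
  simp only [curvatureCoord]
  abel

lemma fderiv_christoffelL_symm (hG : IsRiemannianOn G O) {p : E} (hp : p ∈ O) (u v w : E) :
    fderiv ℝ (christoffelL G) p u v w = fderiv ℝ (christoffelL G) p u w v := by
  have h2 : ∀ v w, fderiv ℝ (fun q ↦ christoffelL G q v w) p u
      = fderiv ℝ (christoffelL G) p u v w := fun v w ↦ by
    rw [(((hG.differentiableAt_christoffelL hp).hasFDerivAt.clm_apply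
      (hasFDerivAt_const v p)).clm_apply (hasFDerivAt_const w p)).fderiv]
    simp
  have h1 : (fun q ↦ christoffelL G q v w) =ᶠ[𝓝 p] fun q ↦ christoffelL G q w v := by
    filter_upwards [hG.isOpen.mem_nhds hp] with q hq using hG.christoffelL_symm hq v w
  rw [← h2, ← h2, h1.fderiv_eq]

/-- Torsion-freeness: the symbols and their derivative are symmetric in the two arguments, so the
cyclic sum cancels in pairs. -/
lemma curvatureCoord_bianchi (hG : IsRiemannianOn G O) {p : E} (hp : p ∈ O) (u v w : E) :
    curvatureCoord G p u v w + curvatureCoord G p v w u + curvatureCoord G p w u v = 0 := by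
  simp only [hG.curvatureCoord_eq hp]
  rw [hG.fderiv_christoffelL_symm hp u w v, hG.fderiv_christoffelL_symm hp v w u,
    hG.fderiv_christoffelL_symm hp w v u, hG.christoffelL_symm hp w u,
    hG.christoffelL_symm hp w v, hG.christoffelL_symm hp v u]
  abel

/-- Using metric compatibility twice expresses D_u D_v G(a, b) through the connection. Second
derivatives of G commute, and the antisymmetric part in u, v of that expression is the left-hand
side. -/
lemma curvatureCoord_skew (hG : IsRiemannianOn G O) {p : E} (hp : p ∈ O) (u v a b : E) :
    G p (curvatureCoord G p u v a) b + G p a (curvatureCoord G p u v b) = 0 := by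
  have hΓ := (hG.differentiableAt_christoffelL hp).hasFDerivAt
  have hGd := (hG.differentiableAt hp).hasFDerivAt
  have key : ∀ u v, fderiv ℝ (fderiv ℝ G) p u v a b
      = G p (fderiv ℝ (christoffelL G) p u v a) b + G p a (fderiv ℝ (christoffelL G) p u v b)
        + (G p (christoffelL G p u (christoffelL G p v a)) b
          + G p (christoffelL G p v a) (christoffelL G p u b))
        + (G p (christoffelL G p u a) (christoffelL G p v b)
          + G p a (christoffelL G p u (christoffelL G p v b))) := fun u v ↦ by
    have h1 : HasFDerivAt (fun q ↦ fderiv ℝ G q v a b) _ p :=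
      (((((hG.contDiffAt hp).fderiv_right (m := 1) (by norm_cast)).differentiableAt
        (by simp)).hasFDerivAt.clm_apply (hasFDerivAt_const v p)).clm_apply
        (hasFDerivAt_const a p)).clm_apply (hasFDerivAt_const b p)
    have h2 : (fun q ↦ fderiv ℝ G q v a b) =ᶠ[𝓝 p] fun q ↦
        G q (christoffelL G q v a) b + G q a (christoffelL G q v b) := by
      filter_upwards [hG.isOpen.mem_nhds hp] with q hq using hG.fderiv_metric hq v a b
    have hc : ∀ a, HasFDerivAt (fun q ↦ christoffelL G q v a) _ p := fun a ↦
      (hΓ.clm_apply (hasFDerivAt_const v p)).clm_apply (hasFDerivAt_const a p)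
    have h3 := ((hGd.clm_apply (hc a)).clm_apply (hasFDerivAt_const b p)).add
      ((hGd.clm_apply (hasFDerivAt_const a p)).clm_apply (hc b))
    have h4 := DFunLike.congr_fun (h1.unique (h3.congr_of_eventuallyEq h2)) u
    simp at h4
    rw [h4, hG.fderiv_metric hp, hG.fderiv_metric hp]
    ring
  have hs : fderiv ℝ (fderiv ℝ G) p u v = fderiv ℝ (fderiv ℝ G) p v u :=
    ((hG.contDiffAt hp).isSymmSndFDerivAt (by simpa using two_le_infty)).eq u v
  have h1 := key u v
  rw [hs, key v u] at h1
  simp only [hG.curvatureCoord_eq hp, map_add, map_sub, add_apply, sub_apply]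
  linarith

/-- The usual octahedron argument: four instances of the first Bianchi identity combined with both
skew symmetries. -/
lemma curvatureCoord_pair_symm (hG : IsRiemannianOn G O) {p : E} (hp : p ∈ O) (u v a b : E) :
    G p (curvatureCoord G p u v a) b = G p (curvatureCoord G p a b u) v := by
  have bi : ∀ u v w c, G p (curvatureCoord G p u v w) c + G p (curvatureCoord G p v w u) c
      + G p (curvatureCoord G p w u v) c = 0 := fun u v w c ↦ by
    have := congrArg (fun y ↦ G p y c) (hG.curvatureCoord_bianchi hp u v w)
    simpa using this
  have sk : ∀ u v a b, G p (curvatureCoord G p u v a) b = - G p (curvatureCoord G p u v b) a :=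
    fun u v a b ↦ by
      have := hG.curvatureCoord_skew hp u v a b
      rw [hG.symm p hp a] at this
      linarith
  have an : ∀ u v a b, G p (curvatureCoord G p u v a) b = - G p (curvatureCoord G p v u a) b :=
    fun u v a b ↦ by rw [curvatureCoord_antisymm]; simp
  linarith [bi u v a b, bi v a b u, bi a b u v, bi b u v a, sk u v a b, sk v a u b, sk a u v b,
    sk v a b u, sk a b v u, sk b v a u, sk a b u v, sk b u a v, sk u a b v, sk b u v a, sk u v b a,
    sk v b u a, an u v a b, an v a u b, an a u v b, an a b u v, an b u a v, an u a b v, an b v a u,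
    an v b a u, an u v b a, an u b v a]

end IsRiemannianOn

end LeviCivita

/-! ### Covariant derivatives along maps -/

section Covariant

variable {E : Type*} [NormedAddCommGroup E] [NormedSpace ℝ E] [FiniteDimensional ℝ E]
  {G : E → E →L[ℝ] E →L[ℝ] ℝ} {O : Set E} {n : ℕ}

/-- The form `η` on `O` is parallel for the Levi-Civita connection of `G`. -/
def IsParallelOn (G : E → E →L[ℝ] E →L[ℝ] ℝ) (O : Set E) (η : E → E [⋀^Fin n]→L[ℝ] ℝ) : Prop :=
  ∀ p ∈ O, ∀ v w, fderiv ℝ η p v w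
    = ∑ i, η p (Function.update w i (christoffelL G p v (w i)))

/-- Covariant derivatives along a curve are compatible with the metric. -/
lemma IsRiemannianOn.hasDerivWithinAt_inner (hG : IsRiemannianOn G O) {γ Y Z : ℝ → E}
    {γ' Y' Z' : E} {S : Set ℝ} {t : ℝ} (ht : γ t ∈ O) (hγ : HasDerivWithinAt γ γ' S t)
    (hY : HasDerivWithinAt Y Y' S t) (hZ : HasDerivWithinAt Z Z' S t) :
    HasDerivWithinAt (fun s ↦ G (γ s) (Y s) (Z s))
      (G (γ t) (Y' + christoffelL G (γ t) γ' (Y t)) (Z t)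
        + G (γ t) (Y t) (Z' + christoffelL G (γ t) γ' (Z t))) S t := by
  have h := (((hG.differentiableAt ht).hasFDerivAt.comp_hasDerivWithinAt t hγ).clm_apply
    hY).clm_apply hZ
  convert! h using 1
  simp only [add_apply, Function.comp_apply, map_add, hG.fderiv_metric ht]
  ring

/-- The derivative along a curve of a parallel form evaluated on vector fields. -/
lemma IsParallelOn.hasDerivWithinAt {η : E → E [⋀^Fin n]→L[ℝ] ℝ} (hη : IsParallelOn G O η)
    {γ : ℝ → E} {Y : Fin n → ℝ → E} {γ' : E} {Y' : Fin n → E} {S : Set ℝ} {t : ℝ}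
    (ht : γ t ∈ O) (hd : DifferentiableAt ℝ η (γ t)) (hγ : HasDerivWithinAt γ γ' S t)
    (hY : ∀ i, HasDerivWithinAt (Y i) (Y' i) S t) :
    HasDerivWithinAt (fun s ↦ η (γ s) (fun i ↦ Y i s))
      (∑ i, η (γ t) (Function.update (fun i ↦ Y i t) i
        (Y' i + christoffelL G (γ t) γ' (Y i t)))) S t := by
  have h := (HasFDerivWithinAt.continuousAlternatingMap_apply
    (hd.hasFDerivAt.comp_hasDerivWithinAt t hγ).hasFDerivWithinAt
    (fun i ↦ (hY i).hasFDerivWithinAt)).hasDerivWithinAt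
  convert! h using 1
  simp [hη _ ht, Finset.sum_add_distrib, ContinuousAlternatingMap.map_update_add, add_comm]

variable {V : Type*} [NormedAddCommGroup V] [NormedSpace ℝ V]

/-- The covariant derivative of a vector field `Y` along the map `f`, in the direction `w`. -/
def cov (G : E → E →L[ℝ] E →L[ℝ] ℝ) (f Y : V → E) (z w : V) : E :=
  fderiv ℝ Y z w + christoffelL G (f z) (fderiv ℝ f z w) (Y z)

lemma hasDerivAt_line {F : Type*} [NormedAddCommGroup F] [NormedSpace ℝ F] {h : V → F} {z : V}
    (hh : DifferentiableAt ℝ h z) (w : V) :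
    HasDerivAt (fun s : ℝ ↦ h (z + s • w)) (fderiv ℝ h z w) 0 :=
  hh.hasFDerivAt.hasLineDerivAt w

lemma IsRiemannianOn.differentiableAt_inner (hG : IsRiemannianOn G O) {f Y Z : V → E} {z : V}
    (hz : f z ∈ O) (hf : DifferentiableAt ℝ f z) (hY : DifferentiableAt ℝ Y z)
    (hZ : DifferentiableAt ℝ Z z) : DifferentiableAt ℝ (fun z ↦ G (f z) (Y z) (Z z)) z :=
  (((hG.differentiableAt hz).comp z hf).clm_apply hY).clm_apply hZ

/-- Restricting to the line s ↦ z + s • w reduces this to the rule along a curve; `fderiv_apply`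
below is obtained in the same way. -/
lemma IsRiemannianOn.fderiv_inner (hG : IsRiemannianOn G O) {f Y Z : V → E} {z : V}
    (hz : f z ∈ O) (hf : DifferentiableAt ℝ f z) (hY : DifferentiableAt ℝ Y z)
    (hZ : DifferentiableAt ℝ Z z) (w : V) :
    fderiv ℝ (fun z ↦ G (f z) (Y z) (Z z)) z w
      = G (f z) (cov G f Y z w) (Z z) + G (f z) (Y z) (cov G f Z z w) := by
  have h1 := hasDerivAt_line (hG.differentiableAt_inner hz hf hY hZ) w
  have h2 := hG.hasDerivWithinAt_inner (S := Set.univ) (t := 0) (by simpa using hz)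
    (hasDerivAt_line hf w).hasDerivWithinAt (hasDerivAt_line hY w).hasDerivWithinAt
    (hasDerivAt_line hZ w).hasDerivWithinAt
  have := h1.unique (hasDerivWithinAt_univ.1 h2)
  simpa [cov] using this

lemma IsParallelOn.fderiv_apply {η : E → E [⋀^Fin n]→L[ℝ] ℝ} (hη : IsParallelOn G O η)
    {f : V → E} {Y : Fin n → V → E} {z : V} (hz : f z ∈ O) (hd : DifferentiableAt ℝ η (f z))
    (hf : DifferentiableAt ℝ f z) (hY : ∀ i, DifferentiableAt ℝ (Y i) z) (w : V) :
    fderiv ℝ (fun z ↦ η (f z) (fun i ↦ Y i z)) z w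
      = ∑ i, η (f z) (Function.update (fun i ↦ Y i z) i (cov G f (Y i) z w)) := by
  have h1 := hasDerivAt_line (DifferentiableAt.continuousAlternatingMap_apply (hd.comp z hf) hY) w
  have h2 := hη.hasDerivWithinAt (S := Set.univ) (t := 0) (γ := fun s ↦ f (z + s • w))
    (by simpa using hz) (by simpa using hd)
    (hasDerivAt_line hf w).hasDerivWithinAt (fun i ↦ (hasDerivAt_line (hY i) w).hasDerivWithinAt)
  have := h1.unique (hasDerivWithinAt_univ.1 h2)
  simpa [cov] using this

/-- The full (ambient) Hessian `∇_v ∂_w f` of the map `f`. -/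
def hess (G : E → E →L[ℝ] E →L[ℝ] ℝ) (f : V → E) (z v w : V) : E :=
  fderiv ℝ (fderiv ℝ f) z v w + christoffelL G (f z) (fderiv ℝ f z v) (fderiv ℝ f z w)

/-- The third order covariant derivative `∇_w ∇_v ∂_u f` of the map `f`. -/
def covHess (G : E → E →L[ℝ] E →L[ℝ] ℝ) (f : V → E) (z w v u : V) : E :=
  fderiv ℝ (fderiv ℝ (fderiv ℝ f)) z w v u
    + (fderiv ℝ (christoffelL G) (f z) (fderiv ℝ f z w) (fderiv ℝ f z v) (fderiv ℝ f z u)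
      + christoffelL G (f z) (fderiv ℝ (fderiv ℝ f) z w v) (fderiv ℝ f z u)
      + christoffelL G (f z) (fderiv ℝ f z v) (fderiv ℝ (fderiv ℝ f) z w u))
    + christoffelL G (f z) (fderiv ℝ f z w) (hess G f z v u)

section Bilinear

lemma hess_add_left (f : V → E) (z v v' w : V) :
    hess G f z (v + v') w = hess G f z v w + hess G f z v' w := by
  simp only [hess, map_add, add_apply]; abel

lemma hess_add_right (f : V → E) (z v w w' : V) :
    hess G f z v (w + w') = hess G f z v w + hess G f z v w' := by
  simp only [hess, map_add]; abel

lemma hess_smul_left (f : V → E) (z v w : V) (c : ℝ) :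
    hess G f z (c • v) w = c • hess G f z v w := by
  simp only [hess, map_smul, smul_apply, smul_add]

lemma hess_smul_right (f : V → E) (z v w : V) (c : ℝ) :
    hess G f z v (c • w) = c • hess G f z v w := by
  simp only [hess, map_smul, smul_add]

end Bilinear

lemma hess_symm (hG : IsRiemannianOn G O) {f : V → E} {z : V} (hz : f z ∈ O)
    (hf : ContDiffAt ℝ ∞ f z) (v w : V) : hess G f z v w = hess G f z w v := by
  rw [hess, hess, (hf.isSymmSndFDerivAt (by simpa using two_le_infty)).eq v w,
    hG.christoffelL_symm hz]

section Derivatives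

variable {f : V → E} {z : V}

lemma _root_.ContDiffAt.fderiv_infty {V F : Type*} [NormedAddCommGroup V] [NormedSpace ℝ V]
    [NormedAddCommGroup F] [NormedSpace ℝ F] {f : V → F} {z : V} (hf : ContDiffAt ℝ ∞ f z) :
    ContDiffAt ℝ ∞ (fderiv ℝ f) z := hf.fderiv_right (by simp)

lemma _root_.ContDiffAt.differentiableAt_infty {V F : Type*} [NormedAddCommGroup V]
    [NormedSpace ℝ V] [NormedAddCommGroup F] [NormedSpace ℝ F] {f : V → F} {z : V}
    (hf : ContDiffAt ℝ ∞ f z) : DifferentiableAt ℝ f z := hf.differentiableAt (by simp)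

lemma cov_fderiv_apply (hf : ContDiffAt ℝ ∞ f z) {b : V → V}
    (hb : DifferentiableAt ℝ b z) (w : V) :
    cov G f (fun z ↦ fderiv ℝ f z (b z)) z w
      = hess G f z w (b z) + fderiv ℝ f z (fderiv ℝ b z w) := by
  rw [cov, fderiv_clm_apply hf.fderiv_infty.differentiableAt_infty hb, hess]
  simp only [add_apply, ContinuousLinearMap.comp_apply, ContinuousLinearMap.flip_apply]
  abel

lemma IsRiemannianOn.differentiableAt_hess (hG : IsRiemannianOn G O) (hz : f z ∈ O)
    (hf : ContDiffAt ℝ ∞ f z) {b c : V → V}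
    (hb : DifferentiableAt ℝ b z) (hc : DifferentiableAt ℝ c z) :
    DifferentiableAt ℝ (fun z ↦ hess G f z (b z) (c z)) z := by
  have h1 := hf.fderiv_infty.differentiableAt_infty
  have h2 := hf.fderiv_infty.fderiv_infty.differentiableAt_infty
  exact ((h2.clm_apply hb).clm_apply hc).add ((((hG.differentiableAt_christoffelL hz).comp z
    hf.differentiableAt_infty).clm_apply (h1.clm_apply hb)).clm_apply (h1.clm_apply hc))

/-- The Leibniz rule that justifies `covHess`: it is the part of the derivative in which the
arguments of the Hessian are held constant in coordinates. -/
lemma IsRiemannianOn.cov_hess (hG : IsRiemannianOn G O) (hz : f z ∈ O)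
    (hf : ContDiffAt ℝ ∞ f z) {b c : V → V}
    (hb : DifferentiableAt ℝ b z) (hc : DifferentiableAt ℝ c z) (w : V) :
    cov G f (fun z ↦ hess G f z (b z) (c z)) z w
      = covHess G f z w (b z) (c z) + hess G f z (fderiv ℝ b z w) (c z)
        + hess G f z (b z) (fderiv ℝ c z w) := by
  have hf0 := hf.differentiableAt_infty.hasFDerivAt
  have h1 := hf.fderiv_infty.differentiableAt_infty.hasFDerivAt
  have h2 := hf.fderiv_infty.fderiv_infty.differentiableAt_infty.hasFDerivAt
  have h := ((h2.clm_apply hb.hasFDerivAt).clm_apply hc.hasFDerivAt).add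
    ((((hG.differentiableAt_christoffelL hz).hasFDerivAt.comp z hf0).clm_apply
      (h1.clm_apply hb.hasFDerivAt)).clm_apply (h1.clm_apply hc.hasFDerivAt))
  have h' : fderiv ℝ (fun z ↦ hess G f z (b z) (c z)) z w = _ := DFunLike.congr_fun h.fderiv w
  rw [cov, h', covHess]
  simp only [hess, add_apply, ContinuousLinearMap.comp_apply, ContinuousLinearMap.flip_apply,
    Function.comp_apply, map_add]
  abel

/-- The Ricci identity. Third derivatives of f commute, and the terms mixing the symbols with second
derivatives cancel in pairs; what survives is the curvature along f. This is the source of the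
curvature term of the theorem. -/
lemma IsRiemannianOn.covHess_sub (hG : IsRiemannianOn G O) (hz : f z ∈ O)
    (hf : ContDiffAt ℝ ∞ f z) (a b c : V) :
    covHess G f z a b c - covHess G f z b a c
      = curvatureCoord G (f z) (fderiv ℝ f z a) (fderiv ℝ f z b) (fderiv ℝ f z c) := by
  rw [hG.curvatureCoord_eq hz]
  simp only [covHess, hess, map_add]
  rw [(hf.fderiv_infty.isSymmSndFDerivAt (by simpa using two_le_infty)).eq a b,
    (hf.isSymmSndFDerivAt (by simpa using two_le_infty)).eq a b]
  abel

lemma cov_add {Y Z : V → E} (hY : DifferentiableAt ℝ Y z) (hZ : DifferentiableAt ℝ Z z) (w : V) :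
    cov G f (fun z ↦ Y z + Z z) z w = cov G f Y z w + cov G f Z z w := by
  have h : fderiv ℝ (fun z ↦ Y z + Z z) z = _ := fderiv_add hY hZ
  rw [cov, h, cov, cov]
  simp only [add_apply, map_add]
  abel

lemma cov_sub {Y Z : V → E} (hY : DifferentiableAt ℝ Y z) (hZ : DifferentiableAt ℝ Z z) (w : V) :
    cov G f (fun z ↦ Y z - Z z) z w = cov G f Y z w - cov G f Z z w := by
  have h : fderiv ℝ (fun z ↦ Y z - Z z) z = _ := fderiv_sub hY hZ
  rw [cov, h, cov, cov]
  simp only [sub_apply, map_sub]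
  abel

lemma cov_smul {a : V → ℝ} {Y : V → E} (ha : DifferentiableAt ℝ a z)
    (hY : DifferentiableAt ℝ Y z) (w : V) :
    cov G f (fun z ↦ a z • Y z) z w = a z • cov G f Y z w + fderiv ℝ a z w • Y z := by
  have h : fderiv ℝ (fun z ↦ a z • Y z) z = _ := fderiv_fun_smul ha hY
  rw [cov, h, cov]
  simp only [add_apply, smul_apply, map_smul, ContinuousLinearMap.smulRight_apply, smul_add]
  abel

lemma cov_sum {ι : Type*} {s : Finset ι} {Y : ι → V → E}
    (hY : ∀ i ∈ s, DifferentiableAt ℝ (Y i) z) (w : V) :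
    cov G f (fun z ↦ ∑ i ∈ s, Y i z) z w = ∑ i ∈ s, cov G f (Y i) z w := by
  rw [cov, fderiv_fun_sum hY]
  simp [cov, Finset.sum_add_distrib]

lemma cov_congr {Y Z : V → E} (h : Y =ᶠ[𝓝 z] Z) (w : V) :
    cov G f Y z w = cov G f Z z w := by
  rw [cov, cov, h.fderiv_eq, h.eq_of_nhds]

end Derivatives

end Covariant

/-! ### Orthonormal systems, normal projection and metric traces -/

section Algebra

variable {E : Type*} [NormedAddCommGroup E] [NormedSpace ℝ E] {n m : ℕ}

/-- The component of `Y` orthogonal to the orthonormal vectors `X 1, …, X n`. -/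
def nor (B : E →L[ℝ] E →L[ℝ] ℝ) (X : Fin n → E) (Y : E) : E :=
  Y - ∑ k, B Y (X k) • X k

lemma nor_add (B : E →L[ℝ] E →L[ℝ] ℝ) (X : Fin n → E) (Y Z : E) :
    nor B X (Y + Z) = nor B X Y + nor B X Z := by
  simp only [nor, map_add, add_apply, add_smul, Finset.sum_add_distrib]
  abel

lemma nor_smul (B : E →L[ℝ] E →L[ℝ] ℝ) (X : Fin n → E) (c : ℝ) (Y : E) :
    nor B X (c • Y) = c • nor B X Y := by
  simp only [nor, map_smul, smul_apply, smul_sub, Finset.smul_sum, smul_smul, smul_eq_mul]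

/-- `nor` as a linear map. -/
def norL (B : E →L[ℝ] E →L[ℝ] ℝ) (X : Fin n → E) : E →ₗ[ℝ] E where
  toFun := nor B X
  map_add' := nor_add B X
  map_smul' := nor_smul B X

lemma norL_apply (B : E →L[ℝ] E →L[ℝ] ℝ) (X : Fin n → E) (Y : E) : norL B X Y = nor B X Y := rfl

section Orthonormal

variable {B : E →L[ℝ] E →L[ℝ] ℝ} {X : Fin n → E}
  (hX : ∀ i j, B (X i) (X j) = if i = j then 1 else 0)

include hX

lemma nor_self (i : Fin n) : nor B X (X i) = 0 := by
  simp [nor, hX]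

lemma inner_nor (Y : E) (i : Fin n) : B (nor B X Y) (X i) = 0 := by
  simp [nor, hX]

end Orthonormal

/-- The right number of orthonormal vectors spans, so the remainder is orthogonal to everything,
itself included, and vanishes by positivity. -/
lemma eq_sum_of_orthonormal [FiniteDimensional ℝ E] {B : E →L[ℝ] E →L[ℝ] ℝ}
    (hpos : ∀ v, v ≠ 0 → 0 < B v v) {ι : Type*} [Fintype ι] [DecidableEq ι] {X : ι → E}
    (hX : ∀ i j, B (X i) (X j) = if i = j then 1 else 0)
    (hcard : Fintype.card ι = Module.finrank ℝ E) (Y : E) :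
    Y = ∑ k, B Y (X k) • X k := by
  let B' : LinearMap.BilinForm ℝ E := LinearMap.mk₂ ℝ (fun v w ↦ B v w) (by simp) (by simp)
    (by simp) (by simp)
  have hli : LinearIndependent ℝ X := by
    refine LinearMap.BilinForm.linearIndependent_of_iIsOrtho (B := B') ?_ ?_
    · intro i j hij
      change B (X i) (X j) = 0
      simp [hX, hij]
    · intro i
      simp [B', hX]
  have hspan := hli.span_eq_top_of_card_eq_finrank' hcard
  set Z := Y - ∑ k, B Y (X k) • X k with hZ
  have h1 : ∀ i, B Z (X i) = 0 := fun i ↦ by simp [hZ, hX]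
  have h2 : ∀ W ∈ Submodule.span ℝ (Set.range X), B Z W = 0 := by
    intro W hW
    induction hW using Submodule.span_induction with
    | mem x hx => obtain ⟨i, rfl⟩ := hx; exact h1 i
    | zero => simp
    | add x y _ _ hx hy => simp [hx, hy]
    | smul a x _ hx => simp [hx]
  have h3 : B Z Z = 0 := h2 Z (by rw [hspan]; trivial)
  have h4 : Z = 0 := by
    by_contra hne
    exact (hpos Z hne).ne' h3
  exact sub_eq_zero.1 h4

lemma nor_eq_sum_normal [FiniteDimensional ℝ E] {B : E →L[ℝ] E →L[ℝ] ℝ}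
    (hsymm : ∀ v w, B v w = B w v) (hpos : ∀ v, v ≠ 0 → 0 < B v v) {X : Fin n → E}
    (hX : ∀ i j, B (X i) (X j) = if i = j then 1 else 0) {ν : Fin m → E}
    (hν : ∀ α β, B (ν α) (ν β) = if α = β then 1 else 0) (hνX : ∀ α i, B (ν α) (X i) = 0)
    (hdim : Module.finrank ℝ E = n + m) (Y : E) :
    nor B X Y = ∑ α, B Y (ν α) • ν α := by
  have h := eq_sum_of_orthonormal hpos (X := Sum.elim X ν) (ι := Fin n ⊕ Fin m)
    (by rintro (i | i) (j | j) <;> simp [hX, hν, hνX, hsymm (X _) (ν _)]) (by simp [hdim]) Y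
  rw [Fintype.sum_sum_type] at h
  simp only [Sum.elim_inl, Sum.elim_inr] at h
  rw [nor, sub_eq_iff_eq_add']
  exact h

/-- If C is the matrix whose rows are the orthonormal vectors, orthonormality reads C L Cᵀ = 1.
Since the matrices are square this gives L⁻¹ = Cᵀ C, which turns the coordinate trace into a sum
over the frame. -/
lemma metricTrace_eq_sum {W : Type*} [AddCommGroup W] [Module ℝ W]
    {Λ : EuclideanSpace ℝ (Fin n) →L[ℝ] EuclideanSpace ℝ (Fin n) →L[ℝ] ℝ}
    {a : Fin n → EuclideanSpace ℝ (Fin n)} (ha : ∀ i j, Λ (a i) (a j) = if i = j then 1 else 0)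
    (b : EuclideanSpace ℝ (Fin n) →ₗ[ℝ] EuclideanSpace ℝ (Fin n) →ₗ[ℝ] W) :
    metricTrace Λ (fun v w ↦ b v w) = ∑ k, b (a k) (a k) := by
  set C : Matrix (Fin n) (Fin n) ℝ := Matrix.of fun k i ↦ a k i with hC
  set L : Matrix (Fin n) (Fin n) ℝ := Matrix.of fun i j ↦ Λ (coordVec i) (coordVec j) with hL
  have hexp : ∀ v : EuclideanSpace ℝ (Fin n), v = ∑ i, v i • coordVec i := fun v ↦ by
    ext j
    simp [coordVec, Pi.single_apply]
  have h1 : C * (L * C.transpose) = 1 := by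
    ext k l
    have h := ha k l
    rw [hexp (a k), hexp (a l)] at h
    simp only [map_sum, map_smul, sum_apply, smul_apply, smul_eq_mul] at h
    rw [Matrix.one_apply, ← h]
    simp only [Matrix.mul_apply, hC, hL, Matrix.of_apply, Matrix.transpose_apply, Finset.mul_sum]
    rw [Finset.sum_comm]
    refine Finset.sum_congr rfl fun i _ ↦ Finset.sum_congr rfl fun j _ ↦ ?_
    ring
  have h2 : L⁻¹ = C.transpose * C := by
    refine Matrix.inv_eq_right_inv ?_
    rw [← Matrix.mul_assoc]
    exact mul_eq_one_comm.1 h1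
  have h3 : ∀ k, b (a k) (a k) = ∑ i, ∑ j, (C k i * C k j) • b (coordVec i) (coordVec j) :=
    fun k ↦ by
      conv_lhs => rw [hexp (a k)]
      simp only [map_sum, map_smul, LinearMap.sum_apply, LinearMap.smul_apply, Finset.smul_sum,
        smul_smul, hC, Matrix.of_apply]
      rw [Finset.sum_comm]
      refine Finset.sum_congr rfl fun i _ ↦ Finset.sum_congr rfl fun j _ ↦ ?_
      rw [mul_comm]
  have h4 : ∑ k, b (a k) (a k)
      = ∑ i, ∑ j, ∑ k, (C k i * C k j) • b (coordVec i) (coordVec j) := by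
    rw [Finset.sum_congr rfl fun k _ ↦ h3 k, Finset.sum_comm]
    exact Finset.sum_congr rfl fun i _ ↦ Finset.sum_comm
  rw [h4]
  unfold metricTrace
  rw [← hL, h2]
  refine Finset.sum_congr rfl fun i _ ↦ Finset.sum_congr rfl fun j _ ↦ ?_
  rw [Matrix.mul_apply, Finset.sum_smul]
  rfl

end Algebra

/-! ### Alternating forms with one or two entries replaced -/

section Alternating

variable {E : Type*} [AddCommGroup E] [Module ℝ E] {n : ℕ} (η : E [⋀^Fin n]→ₗ[ℝ] ℝ)

lemma map_update_sum_smul_self (X : Fin n → E) (i : Fin n) (c : Fin n → ℝ) :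
    η (update X i (∑ k, c k • X k)) = c i * η X := by
  rw [η.map_update_sum, Finset.sum_eq_single i]
  · rw [η.map_update_smul, update_eq_self, smul_eq_mul]
  · intro k _ hk
    rw [η.map_update_smul, η.map_update_self _ hk.symm, smul_zero]
  · simp

lemma map_update_update_self (X : Fin n → E) {i j : Fin n} (hij : i ≠ j) (Y : E) :
    η (update (update X i Y) j (X i)) = - η (update X j Y) := by
  rw [← η.map_swap (update X j Y) hij]
  congr 1
  ext k
  by_cases hk : k = j
  · subst hk
    simp [update_of_ne hij]
  · by_cases hk' : k = i
    · subst hk'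
      simp [update_of_ne hij]
    · simp [update_of_ne hk, update_of_ne hk', Equiv.swap_apply_of_ne_of_ne hk' hk]

/-- Only X i survives in slot j: every X k with k different from i and j repeats an entry, and X j
has coefficient zero. Moving X i back to its own slot costs a sign. -/
lemma map_update_update_sum_smul (X : Fin n → E) {i j : Fin n} (hij : i ≠ j) (Y : E)
    (c : Fin n → ℝ) (hc : c j = 0) :
    η (update (update X i Y) j (∑ k, c k • X k)) = - (c i * η (update X j Y)) := by
  rw [η.map_update_sum, Finset.sum_eq_single i]
  · rw [η.map_update_smul, map_update_update_self η X hij, smul_eq_mul, mul_neg]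
  · intro k _ hk
    rw [η.map_update_smul]
    by_cases hkj : k = j
    · rw [hkj, hc, zero_smul]
    · have : X k = update X i Y k := (update_of_ne hk _ _).symm
      rw [this, η.map_update_self _ (Ne.symm hkj), smul_zero]
  · simp

/-- Replacing two entries of a tuple by vectors whose tangential components are given by a skew
matrix. -/
lemma sum_update_update_of_skew (X A : Fin n → E) (c : Fin n → Fin n → ℝ)
    (hc : ∀ i j, c i j = - c j i) :
    (∑ i, ∑ j, if i = j then 0 else
        η (update (update X i (A i + ∑ k, c i k • X k)) j (A j + ∑ k, c j k • X k)))
      = (∑ i, ∑ j, if i = j then 0 else η (update (update X i (A i)) j (A j)))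
        - 2 * (∑ i, η (update X i (∑ k, c i k • A k)))
        + (∑ i, ∑ j, c i j ^ 2) * η X := by
  have hd : ∀ i, c i i = 0 := fun i ↦ by linarith [hc i i]
  -- For i ≠ j the tangential part of slot j contributes only its X i component and that of slot i
  -- only its X j component. When both are tangential the result is - c i j * c j i * η X, a square
  -- by skewness.
  have h : ∀ i j, (if i = j then 0 else
        η (update (update X i (A i + ∑ k, c i k • X k)) j (A j + ∑ k, c j k • X k)))
      = (if i = j then 0 else η (update (update X i (A i)) j (A j)))
        - c j i * η (update X j (A i)) - c i j * η (update X i (A j)) + c i j ^ 2 * η X := by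
    intro i j
    by_cases hij : i = j
    · subst hij
      simp [hd]
    · have h1 : ∀ Y, η (update (update X i (∑ k, c i k • X k)) j Y)
          = - (c i j * η (update X i Y)) := fun Y ↦ by
        rw [update_comm hij, map_update_update_sum_smul η X (Ne.symm hij) Y _ (hd i)]
      simp only [if_neg hij]
      rw [η.map_update_add, map_update_update_sum_smul η X hij _ _ (hd j), update_comm hij,
        η.map_update_add, ← update_comm hij, ← update_comm hij, h1, η.map_update_add,
        map_update_sum_smul_self, hc j i]
      ring
  simp only [h, Finset.sum_add_distrib, Finset.sum_sub_distrib, ← Finset.sum_mul]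
  have h1 : ∑ i, ∑ j, c j i * η (update X j (A i)) = ∑ i, η (update X i (∑ k, c i k • A k)) := by
    rw [Finset.sum_comm]
    simp [η.map_update_sum, η.map_update_smul]
  have h2 : ∑ i, ∑ j, c i j * η (update X i (A j)) = ∑ i, η (update X i (∑ k, c i k • A k)) := by
    simp [η.map_update_sum, η.map_update_smul]
  rw [h1, h2]
  ring

lemma sum_ne_eq_two_mul (φ : Fin n → Fin n → ℝ) (hφ : ∀ i j, i ≠ j → φ i j = φ j i) :
    (∑ i, ∑ j, if i = j then 0 else φ i j) = 2 * ∑ p, ∑ q with p < q, φ p q := by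
  have h : ∀ i j, (if i = j then 0 else φ i j)
      = (if i < j then φ i j else 0) + (if j < i then φ j i else 0) := fun i j ↦ by
    rcases lt_trichotomy i j with h | h | h
    · simp [h, h.ne, h.not_gt]
    · simp [h]
    · simp [h, h.ne', h.not_gt, hφ i j h.ne']
  simp only [h, Finset.sum_add_distrib, Finset.sum_filter]
  rw [Finset.sum_comm (f := fun i j ↦ if j < i then φ j i else 0)]
  ring

end Alternating

/-! ### Framed immersions: Gauss formula and derivatives of the frame -/

section Frames

variable {E : Type*} [NormedAddCommGroup E] [NormedSpace ℝ E] [FiniteDimensional ℝ E]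
  {G : E → E →L[ℝ] E →L[ℝ] ℝ} {O : Set E} {n m : ℕ}

/-- The image under the differential of `f` of a frame `ε`. -/
def frame (f : EuclideanSpace ℝ (Fin n) → E)
    (ε : Fin n → EuclideanSpace ℝ (Fin n) → EuclideanSpace ℝ (Fin n))
    (z : EuclideanSpace ℝ (Fin n)) (i : Fin n) : E :=
  fderiv ℝ f z (ε i z)

/-- A smooth immersion `f` of the open set `W` into `O`, with a smooth frame `ε`, orthonormal for
the metric induced by `G`. -/
structure FramedImmersion (G : E → E →L[ℝ] E →L[ℝ] ℝ) (O : Set E)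
    (f : EuclideanSpace ℝ (Fin n) → E) (W : Set (EuclideanSpace ℝ (Fin n)))
    (ε : Fin n → EuclideanSpace ℝ (Fin n) → EuclideanSpace ℝ (Fin n)) : Prop where
  riemannian : IsRiemannianOn G O
  isOpen : IsOpen W
  contDiffOn : ContDiffOn ℝ ∞ f W
  mapsTo : ∀ z ∈ W, f z ∈ O
  injective : ∀ z ∈ W, Injective (fderiv ℝ f z)
  contDiffOn_frame : ∀ i, ContDiffOn ℝ ∞ (ε i) W
  orthonormal : ∀ z ∈ W, ∀ i j,
    G (f z) (frame f ε z i) (frame f ε z j) = if i = j then 1 else 0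

namespace FramedImmersion

variable {f : EuclideanSpace ℝ (Fin n) → E} {W : Set (EuclideanSpace ℝ (Fin n))}
  {ε : Fin n → EuclideanSpace ℝ (Fin n) → EuclideanSpace ℝ (Fin n)}
  (hf : FramedImmersion G O f W ε) {z : EuclideanSpace ℝ (Fin n)} (hz : z ∈ W)

include hf

lemma eventually {p : EuclideanSpace ℝ (Fin n) → Prop} (hp : ∀ z ∈ W, p z)
    {z : EuclideanSpace ℝ (Fin n)} (hz : z ∈ W) : ∀ᶠ y in 𝓝 z, p y := by
  filter_upwards [hf.isOpen.mem_nhds hz] with y hy using hp y hy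

include hz

lemma contDiffAt : ContDiffAt ℝ ∞ f z := hf.contDiffOn.contDiffAt (hf.isOpen.mem_nhds hz)

lemma contDiffAt_frame (i : Fin n) : ContDiffAt ℝ ∞ (ε i) z :=
  (hf.contDiffOn_frame i).contDiffAt (hf.isOpen.mem_nhds hz)

lemma contDiffAt_push (i : Fin n) : ContDiffAt ℝ ∞ (fun z ↦ frame f ε z i) z :=
  (hf.contDiffAt hz).fderiv_infty.clm_apply (hf.contDiffAt_frame hz i)

-- Positivity comes from the immersion condition. All the Levi-Civita lemmas thereby apply to the
-- induced metric as well.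
omit hz in
lemma isRiemannianOn_inducedMetric : IsRiemannianOn (inducedMetric G f) W where
  isOpen := hf.isOpen
  contDiffOn := by
    refine contDiffOn_clm_apply.2 fun v ↦ contDiffOn_clm_apply.2 fun w ↦ ?_
    intro z hz
    have h1 := (hf.contDiffAt hz).fderiv_infty
    have h2 : ContDiffAt ℝ ∞ (fun z ↦ G (f z)) z :=
      (hf.riemannian.contDiffAt (hf.mapsTo z hz)).comp z (hf.contDiffAt hz)
    exact ((h2.clm_apply (h1.clm_apply contDiffAt_const)).clm_apply
      (h1.clm_apply contDiffAt_const)).contDiffWithinAt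
  symm z hz v w := hf.riemannian.symm _ (hf.mapsTo z hz) _ _
  pos z hz v hv := hf.riemannian.pos _ (hf.mapsTo z hz) _
    fun h ↦ hv (hf.injective z hz (by simpa using h))

lemma inducedMetric_orthonormal (i j : Fin n) :
    inducedMetric G f z (ε i z) (ε j z) = if i = j then 1 else 0 := hf.orthonormal z hz i j

lemma fderiv_eq_sum (v : EuclideanSpace ℝ (Fin n)) :
    fderiv ℝ f z v = ∑ k, G (f z) (fderiv ℝ f z v) (frame f ε z k) • frame f ε z k := by
  have h := eq_sum_of_orthonormal (hf.isRiemannianOn_inducedMetric.pos z hz) (X := fun i ↦ ε i z)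
    (hf.orthonormal z hz) (by simp) v
  conv_lhs => rw [h]
  simp only [map_sum, map_smul]
  rfl

lemma nor_fderiv (v : EuclideanSpace ℝ (Fin n)) :
    nor (G (f z)) (frame f ε z) (fderiv ℝ f z v) = 0 := by
  rw [nor, ← hf.fderiv_eq_sum hz, sub_self]

/-- The tangential component of the Hessian of `f` is given by the Christoffel symbols of the
induced metric. -/
lemma hess_eq (v w : EuclideanSpace ℝ (Fin n)) :
    hess G f z v w = nor (G (f z)) (frame f ε z) (hess G f z v w)
      + fderiv ℝ f z (christoffelL (inducedMetric G f) z v w) := by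
  have hO := hf.mapsTo z hz
  have h1 := (hf.contDiffAt hz).fderiv_infty.differentiableAt_infty
  have hd : ∀ a b c, fderiv ℝ (inducedMetric G f) z a b c
      = G (f z) (hess G f z a b) (fderiv ℝ f z c)
        + G (f z) (fderiv ℝ f z b) (hess G f z a c) := fun a b c ↦ by
    have h2 : fderiv ℝ (fun y ↦ inducedMetric G f y b c) z a
        = fderiv ℝ (inducedMetric G f) z a b c := by
      rw [(((hf.isRiemannianOn_inducedMetric.differentiableAt hz).hasFDerivAt.clm_apply
        (hasFDerivAt_const b z)).clm_apply (hasFDerivAt_const c z)).fderiv]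
      simp
    have h3 := hf.riemannian.fderiv_inner hO (hf.contDiffAt hz).differentiableAt_infty
      (h1.clm_apply (differentiableAt_const b)) (h1.clm_apply (differentiableAt_const c)) a
    rw [cov_fderiv_apply (hf.contDiffAt hz) (differentiableAt_const b),
      cov_fderiv_apply (hf.contDiffAt hz) (differentiableAt_const c)] at h3
    simp only [fderiv_fun_const, Pi.zero_apply, zero_apply, map_zero, add_zero] at h3
    rw [← h2]
    exact h3
  -- Koszul's formula for the induced metric, whose derivative is written through Hessians by `hd`;
  -- symmetry of the Hessian leaves a single term.
  have key : ∀ u, G (f z) (fderiv ℝ f z (christoffelL (inducedMetric G f) z v w)) (fderiv ℝ f z u)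
      = G (f z) (hess G f z v w) (fderiv ℝ f z u) := fun u ↦ by
    have h4 := hf.isRiemannianOn_inducedMetric.metric_christoffelL hz v w u
    rw [hd, hd, hd, hess_symm hf.riemannian hO (hf.contDiffAt hz) w v,
      hess_symm hf.riemannian hO (hf.contDiffAt hz) u v,
      hess_symm hf.riemannian hO (hf.contDiffAt hz) u w,
      hf.riemannian.symm _ hO (fderiv ℝ f z w), hf.riemannian.symm _ hO (fderiv ℝ f z v)] at h4
    change inducedMetric G f z _ _ = _
    rw [h4]
    ring
  rw [hf.fderiv_eq_sum hz (christoffelL _ _ _ _), nor]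
  simp only [frame, key]
  abel

lemma normalPart_eq (Y : E) : normalPart G f z Y = nor (G (f z)) (frame f ε z) Y := by
  let b : EuclideanSpace ℝ (Fin n) →ₗ[ℝ] EuclideanSpace ℝ (Fin n) →ₗ[ℝ] E :=
    LinearMap.mk₂ ℝ (fun v w ↦ G (f z) Y (fderiv ℝ f z v) • fderiv ℝ f z w)
      (by simp [add_smul]) (by simp [smul_smul]) (by simp)
      (fun c v w ↦ by rw [map_smul, smul_comm])
  have := metricTrace_eq_sum (hf.inducedMetric_orthonormal hz) b
  rw [normalPart, nor]
  congr 1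

lemma secondFundCoord_eq (v w : EuclideanSpace ℝ (Fin n)) :
    secondFundCoord G f z v w = nor (G (f z)) (frame f ε z) (hess G f z v w) := by
  rw [secondFundCoord, hf.normalPart_eq hz, hess, christoffelL_apply]

lemma meanCurvCoord_eq : meanCurvCoord G f z
    = ∑ k, nor (G (f z)) (frame f ε z) (hess G f z (ε k z) (ε k z)) := by
  let b : EuclideanSpace ℝ (Fin n) →ₗ[ℝ] EuclideanSpace ℝ (Fin n) →ₗ[ℝ] E :=
    LinearMap.mk₂ ℝ (fun v w ↦ nor (G (f z)) (frame f ε z) (hess G f z v w))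
      (by simp [hess_add_left, nor_add]) (by simp [hess_smul_left, nor_smul])
      (by simp [hess_add_right, nor_add]) (by simp [hess_smul_right, nor_smul])
  have := metricTrace_eq_sum (hf.inducedMetric_orthonormal hz) b
  have h2 : secondFundCoord G f z = fun v w ↦ b v w := by
    ext1 v
    ext1 w
    exact hf.secondFundCoord_eq hz v w
  rw [meanCurvCoord, h2, this]
  rfl

lemma laplacianCoord_eq (u : EuclideanSpace ℝ (Fin n) → ℝ) :
    laplacianCoord (inducedMetric G f) u z
      = ∑ k, (fderiv ℝ (fderiv ℝ u) z (ε k z) (ε k z)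
        - fderiv ℝ u z (christoffelL (inducedMetric G f) z (ε k z) (ε k z))) := by
  let b : EuclideanSpace ℝ (Fin n) →ₗ[ℝ] EuclideanSpace ℝ (Fin n) →ₗ[ℝ] ℝ :=
    LinearMap.mk₂ ℝ (fun v w ↦ fderiv ℝ (fderiv ℝ u) z v w
        - fderiv ℝ u z (christoffelL (inducedMetric G f) z v w))
      (fun _ _ _ ↦ by simp; ring) (fun _ _ _ ↦ by simp; ring) (fun _ _ _ ↦ by simp; ring)
      (fun _ _ _ ↦ by simp; ring)
  have := metricTrace_eq_sum (hf.inducedMetric_orthonormal hz) b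
  simp only [laplacianCoord, ← christoffelL_apply]
  exact this

/-! ### Covariant derivatives of the frame -/

/-- The covariant derivative of the frame. -/
lemma cov_frame (i : Fin n) (w : EuclideanSpace ℝ (Fin n)) :
    cov G f (fun z ↦ frame f ε z i) z w
      = hess G f z w (ε i z) + fderiv ℝ f z (fderiv ℝ (ε i) z w) :=
  cov_fderiv_apply (hf.contDiffAt hz) (hf.contDiffAt_frame hz i).differentiableAt_infty w

/-- Differentiate the constant ⟨X_i, X_j⟩. The coefficients c_ij = ⟨∇_w X_i, X_j⟩ are the only trace
of the choice of frame, and their skewness is what makes it disappear. -/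
lemma inner_cov_frame_skew (i j : Fin n) (w : EuclideanSpace ℝ (Fin n)) :
    G (f z) (cov G f (fun z ↦ frame f ε z i) z w) (frame f ε z j)
      = - G (f z) (cov G f (fun z ↦ frame f ε z j) z w) (frame f ε z i) := by
  have hO := hf.mapsTo z hz
  have h1 := hf.riemannian.fderiv_inner hO (hf.contDiffAt hz).differentiableAt_infty
    (hf.contDiffAt_push hz i).differentiableAt_infty
    (hf.contDiffAt_push hz j).differentiableAt_infty w
  have h2 : (fun z ↦ G (f z) (frame f ε z i) (frame f ε z j))
      =ᶠ[𝓝 z] fun _ ↦ if i = j then 1 else 0 := hf.eventually (fun z hz ↦ hf.orthonormal z hz i j) hz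
  rw [h2.fderiv_eq] at h1
  simp only [fderiv_fun_const, Pi.zero_apply, zero_apply] at h1
  rw [hf.riemannian.symm _ hO (frame f ε z i)] at h1
  linarith

lemma nor_cov_frame (i : Fin n) (w : EuclideanSpace ℝ (Fin n)) :
    nor (G (f z)) (frame f ε z) (cov G f (fun z ↦ frame f ε z i) z w)
      = nor (G (f z)) (frame f ε z) (hess G f z w (ε i z)) := by
  rw [hf.cov_frame hz, nor_add, hf.nor_fderiv hz, add_zero]

lemma cov_frame_eq (i : Fin n) (w : EuclideanSpace ℝ (Fin n)) :
    cov G f (fun z ↦ frame f ε z i) z w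
      = nor (G (f z)) (frame f ε z) (hess G f z w (ε i z))
        + ∑ k, G (f z) (cov G f (fun z ↦ frame f ε z i) z w) (frame f ε z k) • frame f ε z k := by
  rw [← hf.nor_cov_frame hz, nor]
  abel

/-- Compare the tangential parts of the two expressions for ∇_w X_i, from the Gauss formula and from
the expansion in the frame, and use injectivity of df. Derivatives of ε are thus traded for induced
Christoffel symbols and the skew coefficients. -/
lemma fderiv_frame_eq (i : Fin n) (w : EuclideanSpace ℝ (Fin n)) :
    fderiv ℝ (ε i) z w = - christoffelL (inducedMetric G f) z w (ε i z)
      + ∑ k, G (f z) (cov G f (fun z ↦ frame f ε z i) z w) (frame f ε z k) • ε k z := by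
  apply hf.injective z hz
  have h1 := hf.cov_frame hz i w
  rw [hf.hess_eq hz] at h1
  have h2 := hf.cov_frame_eq hz i w
  simp only [map_add, map_neg, map_sum, map_smul]
  change _ = _ + ∑ k, G (f z) (cov G f (fun z ↦ frame f ε z i) z w) (frame f ε z k) • frame f ε z k
  rw [h1, add_assoc, add_right_inj] at h2
  rw [h1, add_assoc, ← h2]
  abel

end FramedImmersion

end Frames

/-! ### Second derivatives: Laplacian of the form and normal derivative of the mean curvature -/

section SecondOrder

variable {E : Type*} [NormedAddCommGroup E] [NormedSpace ℝ E] [FiniteDimensional ℝ E]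
  {G : E → E →L[ℝ] E →L[ℝ] ℝ} {O : Set E} {n m : ℕ}

lemma differentiableAt_of_forall_apply {V F : Type*} [NormedAddCommGroup V] [NormedSpace ℝ V]
    [FiniteDimensional ℝ V] [NormedAddCommGroup F] [NormedSpace ℝ F] {D : Type*}
    [NormedAddCommGroup D] [NormedSpace ℝ D] {h : D → V →L[ℝ] F} {z : D}
    (hh : ∀ v, DifferentiableAt ℝ (fun y ↦ h y v) z) : DifferentiableAt ℝ h z := by
  let e₁ := ContinuousLinearEquiv.ofFinrankEq (𝕜 := ℝ) (E := V)
    (F := Fin (Module.finrank ℝ V) → ℝ) (by simp)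
  let e₂ := (e₁.arrowCongr (1 : F ≃L[ℝ] F)).trans (ContinuousLinearEquiv.piRing (Fin _))
  rw [← Function.id_comp h, ← e₂.symm_comp_self]
  exact e₂.symm.differentiable.differentiableAt.comp z (differentiableAt_pi.2 fun i ↦ hh _)

namespace FramedImmersion

variable {f : EuclideanSpace ℝ (Fin n) → E} {W : Set (EuclideanSpace ℝ (Fin n))}
  {ε : Fin n → EuclideanSpace ℝ (Fin n) → EuclideanSpace ℝ (Fin n)}
  (hf : FramedImmersion G O f W ε) {z : EuclideanSpace ℝ (Fin n)} (hz : z ∈ W)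

include hf hz

/-- Differentiate the symmetry of the Hessian, with constant arguments. -/
lemma covHess_symm (w v u : EuclideanSpace ℝ (Fin n)) :
    covHess G f z w v u = covHess G f z w u v := by
  have hO := hf.mapsTo z hz
  have h1 := hf.riemannian.cov_hess hO (hf.contDiffAt hz) (differentiableAt_const v)
    (differentiableAt_const u) w
  have h2 := hf.riemannian.cov_hess hO (hf.contDiffAt hz) (differentiableAt_const u)
    (differentiableAt_const v) w
  have h3 : (fun y ↦ hess G f y v u) =ᶠ[𝓝 z] fun y ↦ hess G f y u v :=
    hf.eventually (fun y hy ↦ hess_symm hf.riemannian (hf.mapsTo y hy) (hf.contDiffAt hy) v u) hz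
  rw [cov_congr h3, h2] at h1
  simpa [hess] using h1.symm

lemma cov_frame_eventuallyEq (i : Fin n) (w : EuclideanSpace ℝ (Fin n)) :
    (fun y ↦ cov G f (fun z ↦ frame f ε z i) y w) =ᶠ[𝓝 z]
      fun y ↦ hess G f y w (ε i y) + fderiv ℝ f y (fderiv ℝ (ε i) y w) :=
  hf.eventually (fun _ hy ↦ hf.cov_frame hy i w) hz

lemma differentiableAt_fderiv_frame (i : Fin n) (w : EuclideanSpace ℝ (Fin n)) :
    DifferentiableAt ℝ (fun y ↦ fderiv ℝ (ε i) y w) z :=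
  (hf.contDiffAt_frame hz i).fderiv_infty.differentiableAt_infty.clm_apply
    (differentiableAt_const w)

lemma differentiableAt_hess_const_frame (i : Fin n) (w : EuclideanSpace ℝ (Fin n)) :
    DifferentiableAt ℝ (fun y ↦ hess G f y w (ε i y)) z :=
  hf.riemannian.differentiableAt_hess (hf.mapsTo z hz) (hf.contDiffAt hz)
    (differentiableAt_const w) (hf.contDiffAt_frame hz i).differentiableAt_infty

lemma differentiableAt_push_fderiv_frame (i : Fin n) (w : EuclideanSpace ℝ (Fin n)) :
    DifferentiableAt ℝ (fun y ↦ fderiv ℝ f y (fderiv ℝ (ε i) y w)) z :=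
  (hf.contDiffAt hz).fderiv_infty.differentiableAt_infty.clm_apply
    (hf.differentiableAt_fderiv_frame hz i w)

lemma differentiableAt_cov_frame (i : Fin n) (w : EuclideanSpace ℝ (Fin n)) :
    DifferentiableAt ℝ (fun y ↦ cov G f (fun z ↦ frame f ε z i) y w) z :=
  ((hf.differentiableAt_hess_const_frame hz i w).add
    (hf.differentiableAt_push_fderiv_frame hz i w)).congr_of_eventuallyEq
    (hf.cov_frame_eventuallyEq hz i w)

lemma hess_fderiv_frame (i : Fin n) (v w : EuclideanSpace ℝ (Fin n)) :
    hess G f z v (fderiv ℝ (ε i) z w)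
      = - hess G f z v (christoffelL (inducedMetric G f) z w (ε i z))
        + ∑ k, G (f z) (cov G f (fun z ↦ frame f ε z i) z w) (frame f ε z k)
          • hess G f z v (ε k z) := by
  rw [hf.fderiv_frame_eq hz]
  simp only [hess, map_add, map_neg, map_sum, map_smul, smul_add, Finset.sum_add_distrib]
  abel

/-- The normal component of the second covariant derivative of the frame. -/
lemma nor_cov_cov_frame (i : Fin n) (w : EuclideanSpace ℝ (Fin n)) :
    nor (G (f z)) (frame f ε z) (cov G f (fun y ↦ cov G f (fun z ↦ frame f ε z i) y w) z w)
      = nor (G (f z)) (frame f ε z) (covHess G f z w w (ε i z))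
        - (2 : ℝ) • nor (G (f z)) (frame f ε z)
          (hess G f z w (christoffelL (inducedMetric G f) z w (ε i z)))
        + (2 : ℝ) • ∑ k, G (f z) (cov G f (fun z ↦ frame f ε z i) z w) (frame f ε z k)
          • nor (G (f z)) (frame f ε z) (hess G f z w (ε k z)) := by
  rw [cov_congr (hf.cov_frame_eventuallyEq hz i w),
    cov_add (hf.differentiableAt_hess_const_frame hz i w)
      (hf.differentiableAt_push_fderiv_frame hz i w),
    hf.riemannian.cov_hess (hf.mapsTo z hz) (hf.contDiffAt hz) (differentiableAt_const w)
      (hf.contDiffAt_frame hz i).differentiableAt_infty,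
    cov_fderiv_apply (hf.contDiffAt hz) (hf.differentiableAt_fderiv_frame hz i w),
    hf.hess_fderiv_frame hz]
  have h0 : hess G f z (fderiv ℝ (fun _ : EuclideanSpace ℝ (Fin n) ↦ w) z w) (ε i z) = 0 := by
    simp [hess]
  rw [h0]
  simp only [← norL_apply, map_add, map_neg, map_sum, map_smul, map_zero]
  rw [norL_apply _ _ (fderiv ℝ f z _), hf.nor_fderiv hz]
  module

/-- The tangential trace of the second covariant derivative of the frame. -/
lemma inner_cov_cov_frame (i : Fin n) (w : EuclideanSpace ℝ (Fin n)) :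
    G (f z) (cov G f (fun y ↦ cov G f (fun z ↦ frame f ε z i) y w) z w) (frame f ε z i)
      = - (G (f z) (nor (G (f z)) (frame f ε z) (hess G f z w (ε i z)))
            (nor (G (f z)) (frame f ε z) (hess G f z w (ε i z)))
          + ∑ k, G (f z) (cov G f (fun z ↦ frame f ε z i) z w) (frame f ε z k) ^ 2) := by
  have hO := hf.mapsTo z hz
  have h1 := hf.riemannian.fderiv_inner hO (hf.contDiffAt hz).differentiableAt_infty
    (hf.differentiableAt_cov_frame hz i w) (hf.contDiffAt_push hz i).differentiableAt_infty w
  -- By skewness ⟨∇_w X_i, X_i⟩ vanishes on a whole neighbourhood. Its derivative gives ⟨∇_w ∇_w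
  -- X_i, X_i⟩ = -|∇_w X_i|², and Pythagoras splits the square.
  have h2 : (fun y ↦ G (f y) (cov G f (fun z ↦ frame f ε z i) y w) (frame f ε y i))
      =ᶠ[𝓝 z] fun _ ↦ 0 :=
    hf.eventually (fun y hy ↦ by linarith [hf.inner_cov_frame_skew hy i i w]) hz
  rw [h2.fderiv_eq] at h1
  simp only [fderiv_fun_const, Pi.zero_apply, zero_apply] at h1
  have h3 : G (f z) (cov G f (fun z ↦ frame f ε z i) z w) (cov G f (fun z ↦ frame f ε z i) z w)
      = G (f z) (nor (G (f z)) (frame f ε z) (hess G f z w (ε i z)))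
            (nor (G (f z)) (frame f ε z) (hess G f z w (ε i z)))
          + ∑ k, G (f z) (cov G f (fun z ↦ frame f ε z i) z w) (frame f ε z k) ^ 2 := by
    conv_lhs => enter [2]; rw [hf.cov_frame_eq hz]
    rw [map_add, map_sum]
    congr 1
    · rw [hf.cov_frame_eq hz]
      simp [hf.riemannian.symm _ hO (frame f ε z _), inner_nor (hf.orthonormal z hz)]
    · simp [sq]
  linarith

variable {η : E → E [⋀^Fin n]→L[ℝ] ℝ}

lemma fderiv_form (hη : IsParallelOn G O η) (hd : ∀ p ∈ O, DifferentiableAt ℝ η p)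
    (w : EuclideanSpace ℝ (Fin n)) :
    fderiv ℝ (fun z ↦ η (f z) (frame f ε z)) z w
      = ∑ i, η (f z) (update (frame f ε z) i (cov G f (fun z ↦ frame f ε z i) z w)) :=
  hη.fderiv_apply (hf.mapsTo z hz) (hd _ (hf.mapsTo z hz))
    (hf.contDiffAt hz).differentiableAt_infty
    (fun i ↦ (hf.contDiffAt_push hz i).differentiableAt_infty) w

lemma map_update_eq_nor (i : Fin n) (Y : E) :
    η (f z) (update (frame f ε z) i Y)
      = η (f z) (update (frame f ε z) i (nor (G (f z)) (frame f ε z) Y))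
        + G (f z) Y (frame f ε z i) * η (f z) (frame f ε z) := by
  have h : Y = nor (G (f z)) (frame f ε z) Y
      + ∑ k, G (f z) Y (frame f ε z k) • frame f ε z k := by rw [nor]; abel
  conv_lhs => rw [h, ContinuousAlternatingMap.map_update_add]
  congr 1
  exact map_update_sum_smul_self (η (f z)).toAlternatingMap _ _ _

lemma fderiv_form_eq_nor (hη : IsParallelOn G O η) (hd : ∀ p ∈ O, DifferentiableAt ℝ η p)
    (w : EuclideanSpace ℝ (Fin n)) :
    fderiv ℝ (fun z ↦ η (f z) (frame f ε z)) z w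
      = ∑ i, η (f z) (update (frame f ε z) i
          (nor (G (f z)) (frame f ε z) (hess G f z w (ε i z)))) := by
  rw [hf.fderiv_form hz hη hd]
  refine Finset.sum_congr rfl fun i _ ↦ ?_
  rw [hf.map_update_eq_nor hz, hf.nor_cov_frame hz]
  have := hf.inner_cov_frame_skew hz i i w
  rw [show G (f z) (cov G f (fun z ↦ frame f ε z i) z w) (frame f ε z i) = 0 by linarith]
  ring

lemma differentiableAt_update_cov_frame (i j : Fin n) (w : EuclideanSpace ℝ (Fin n)) :
    DifferentiableAt ℝ (fun y ↦ update (frame f ε y) i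
      (cov G f (fun z ↦ frame f ε z i) y w) j) z := by
  by_cases hij : j = i
  · subst hij
    simpa using hf.differentiableAt_cov_frame hz j w
  · simpa [update_of_ne hij] using (hf.contDiffAt_push hz j).differentiableAt_infty

lemma differentiableAt_fderiv_form (hη : IsParallelOn G O η)
    (hd : ∀ p ∈ O, DifferentiableAt ℝ η p) :
    DifferentiableAt ℝ (fderiv ℝ (fun z ↦ η (f z) (frame f ε z))) z := by
  refine differentiableAt_of_forall_apply fun w ↦ ?_
  have h : (fun y ↦ fderiv ℝ (fun z ↦ η (f z) (frame f ε z)) y w) =ᶠ[𝓝 z] fun y ↦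
      ∑ i, η (f y) (fun j ↦ update (frame f ε y) i (cov G f (fun z ↦ frame f ε z i) y w) j) :=
    hf.eventually (fun y hy ↦ hf.fderiv_form hy hη hd w) hz
  refine DifferentiableAt.congr_of_eventuallyEq ?_ h
  refine DifferentiableAt.fun_sum fun i _ ↦ ?_
  exact DifferentiableAt.continuousAlternatingMap_apply
    ((hd _ (hf.mapsTo z hz)).comp z (hf.contDiffAt hz).differentiableAt_infty)
    (fun j ↦ hf.differentiableAt_update_cov_frame hz i j w)

/-- The result does not involve the coefficients c. The linear terms from the normal part of ∇_w ∇_w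
X_i cancel those of `sum_update_update_of_skew`, and the -∑ c² from its X_i component cancels the +∑
c² there. -/
lemma fderiv_fderiv_form (hη : IsParallelOn G O η) (hd : ∀ p ∈ O, DifferentiableAt ℝ η p)
    (w : EuclideanSpace ℝ (Fin n)) :
    fderiv ℝ (fderiv ℝ (fun z ↦ η (f z) (frame f ε z))) z w w
      = ∑ i, η (f z) (update (frame f ε z) i
          (nor (G (f z)) (frame f ε z) (covHess G f z w w (ε i z))
          - (2 : ℝ) • nor (G (f z)) (frame f ε z)
              (hess G f z w (christoffelL (inducedMetric G f) z w (ε i z)))))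
        - (∑ i, G (f z) (nor (G (f z)) (frame f ε z) (hess G f z w (ε i z)))
            (nor (G (f z)) (frame f ε z) (hess G f z w (ε i z)))) * η (f z) (frame f ε z)
        + ∑ i, ∑ j, if i = j then 0 else
          η (f z) (update (update (frame f ε z) i
            (nor (G (f z)) (frame f ε z) (hess G f z w (ε i z)))) j
            (nor (G (f z)) (frame f ε z) (hess G f z w (ε j z)))) := by
  have hO := hf.mapsTo z hz
  have hfd := (hf.contDiffAt hz).differentiableAt_infty
  set Z : Fin n → EuclideanSpace ℝ (Fin n) → E :=
    fun i y ↦ cov G f (fun z ↦ frame f ε z i) y w with hZ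
  have h1 : fderiv ℝ (fderiv ℝ (fun z ↦ η (f z) (frame f ε z))) z w w
      = fderiv ℝ (fun y ↦ fderiv ℝ (fun z ↦ η (f z) (frame f ε z)) y w) z w := by
    rw [fderiv_clm_apply (hf.differentiableAt_fderiv_form hz hη hd) (differentiableAt_const w)]
    simp
  have h2 : (fun y ↦ fderiv ℝ (fun z ↦ η (f z) (frame f ε z)) y w) =ᶠ[𝓝 z] fun y ↦
      ∑ i, η (f y) (fun j ↦ update (frame f ε y) i (Z i y) j) :=
    hf.eventually (fun y hy ↦ hf.fderiv_form hy hη hd w) hz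
  have h3 : ∀ i, fderiv ℝ (fun y ↦ η (f y) (fun j ↦ update (frame f ε y) i (Z i y) j)) z w
      = ∑ j, if i = j then η (f z) (update (frame f ε z) i (cov G f (Z i) z w))
        else η (f z) (update (update (frame f ε z) i (Z i z)) j (Z j z)) := fun i ↦ by
    rw [hη.fderiv_apply hO (hd _ hO) hfd
      (fun j ↦ hf.differentiableAt_update_cov_frame hz i j w)]
    refine Finset.sum_congr rfl fun j _ ↦ ?_
    by_cases hij : i = j
    · subst hij
      simp only [if_true, update_self]
      exact congrArg (η (f z)) (update_idem _ _ _)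
    · simp only [if_neg hij, update_of_ne (Ne.symm hij)]
      rfl
  have h4 : ∀ i, fderiv ℝ (fun y ↦ η (f y) (fun j ↦ update (frame f ε y) i (Z i y) j)) z w
      = η (f z) (update (frame f ε z) i (cov G f (Z i) z w)) + ∑ j, if i = j then 0
        else η (f z) (update (update (frame f ε z) i (Z i z)) j (Z j z)) := fun i ↦ by
    rw [h3 i, ← sub_eq_iff_eq_add, ← Finset.sum_sub_distrib, Finset.sum_eq_single i]
    · simp
    · intro j _ hj
      simp [Ne.symm hj]
    · simp
  have h5 := sum_update_update_of_skew (η (f z)).toAlternatingMap (frame f ε z)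
    (fun i ↦ nor (G (f z)) (frame f ε z) (hess G f z w (ε i z)))
    (fun i k ↦ G (f z) (Z i z) (frame f ε z k)) (fun i j ↦ hf.inner_cov_frame_skew hz i j w)
  simp only [hZ, ← hf.cov_frame_eq hz] at h5
  change (∑ i, ∑ j, if i = j then 0
        else η (f z) (update (update (frame f ε z) i (Z i z)) j (Z j z))) = _ at h5
  rw [h1, h2.fderiv_eq, fderiv_fun_sum, sum_apply]
  swap
  · intro i _
    exact DifferentiableAt.continuousAlternatingMap_apply ((hd _ hO).comp z hfd)
      (fun j ↦ hf.differentiableAt_update_cov_frame hz i j w)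
  rw [Finset.sum_congr rfl fun i _ ↦ h4 i, Finset.sum_add_distrib, h5]
  have h6 : ∀ i, η (f z) (update (frame f ε z) i (cov G f (Z i) z w))
      = η (f z) (update (frame f ε z) i
          (nor (G (f z)) (frame f ε z) (covHess G f z w w (ε i z))
          - (2 : ℝ) • nor (G (f z)) (frame f ε z)
              (hess G f z w (christoffelL (inducedMetric G f) z w (ε i z)))))
        + 2 * η (f z) (update (frame f ε z) i (∑ k, G (f z) (Z i z) (frame f ε z k)
          • nor (G (f z)) (frame f ε z) (hess G f z w (ε k z))))
        - (G (f z) (nor (G (f z)) (frame f ε z) (hess G f z w (ε i z)))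
            (nor (G (f z)) (frame f ε z) (hess G f z w (ε i z)))
          + ∑ k, G (f z) (Z i z) (frame f ε z k) ^ 2) * η (f z) (frame f ε z) := fun i ↦ by
    rw [hf.map_update_eq_nor hz, hf.nor_cov_cov_frame hz, hf.inner_cov_cov_frame hz,
      ContinuousAlternatingMap.map_update_add, ContinuousAlternatingMap.map_update_smul,
      smul_eq_mul]
    ring
  rw [Finset.sum_congr rfl fun i _ ↦ h6 i]
  simp only [Finset.sum_add_distrib, Finset.sum_sub_distrib, ← Finset.sum_mul, ← Finset.mul_sum]
  simp only [ContinuousAlternatingMap.coe_toAlternatingMap]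
  ring

/-- The Laplacian of a parallel form evaluated on an orthonormal frame. -/
lemma laplacianCoord_form (hη : IsParallelOn G O η) (hd : ∀ p ∈ O, DifferentiableAt ℝ η p) :
    laplacianCoord (inducedMetric G f) (fun z ↦ η (f z) (frame f ε z)) z
      = ∑ k, (∑ i, η (f z) (update (frame f ε z) i (nor (G (f z)) (frame f ε z)
            (covHess G f z (ε k z) (ε k z) (ε i z)
            - (2 : ℝ) • hess G f z (ε k z)
              (christoffelL (inducedMetric G f) z (ε k z) (ε i z))
            - hess G f z (christoffelL (inducedMetric G f) z (ε k z) (ε k z)) (ε i z))))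
        - (∑ i, G (f z) (nor (G (f z)) (frame f ε z) (hess G f z (ε k z) (ε i z)))
            (nor (G (f z)) (frame f ε z) (hess G f z (ε k z) (ε i z)))) * η (f z) (frame f ε z)
        + ∑ i, ∑ j, if i = j then 0 else
          η (f z) (update (update (frame f ε z) i
            (nor (G (f z)) (frame f ε z) (hess G f z (ε k z) (ε i z)))) j
            (nor (G (f z)) (frame f ε z) (hess G f z (ε k z) (ε j z))))) := by
  rw [hf.laplacianCoord_eq hz]
  refine Finset.sum_congr rfl fun k _ ↦ ?_
  rw [hf.fderiv_fderiv_form hz hη hd, hf.fderiv_form_eq_nor hz hη hd]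
  have h : ∀ i, η (f z) (update (frame f ε z) i (nor (G (f z)) (frame f ε z)
            (covHess G f z (ε k z) (ε k z) (ε i z)
            - (2 : ℝ) • hess G f z (ε k z)
              (christoffelL (inducedMetric G f) z (ε k z) (ε i z))
            - hess G f z (christoffelL (inducedMetric G f) z (ε k z) (ε k z)) (ε i z))))
      = η (f z) (update (frame f ε z) i
          (nor (G (f z)) (frame f ε z) (covHess G f z (ε k z) (ε k z) (ε i z))
          - (2 : ℝ) • nor (G (f z)) (frame f ε z)
              (hess G f z (ε k z) (christoffelL (inducedMetric G f) z (ε k z) (ε i z)))))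
        - η (f z) (update (frame f ε z) i (nor (G (f z)) (frame f ε z)
          (hess G f z (christoffelL (inducedMetric G f) z (ε k z) (ε k z)) (ε i z)))) :=
    fun i ↦ by
      rw [← ContinuousAlternatingMap.map_update_sub]
      simp only [← norL_apply, map_sub, map_smul]
  rw [Finset.sum_congr rfl fun i _ ↦ h i, Finset.sum_sub_distrib]
  ring

/-- The normal component of the derivative of the mean curvature vector. -/
lemma nor_cov_meanCurvCoord (w : EuclideanSpace ℝ (Fin n)) :
    nor (G (f z)) (frame f ε z) (cov G f (meanCurvCoord G f) z w)
      = nor (G (f z)) (frame f ε z) (∑ k, (covHess G f z w (ε k z) (ε k z)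
          - (2 : ℝ) • hess G f z (ε k z) (christoffelL (inducedMetric G f) z w (ε k z))
          - hess G f z w (christoffelL (inducedMetric G f) z (ε k z) (ε k z)))) := by
  have hO := hf.mapsTo z hz
  have hfd := (hf.contDiffAt hz).differentiableAt_infty
  have hεd := fun k ↦ (hf.contDiffAt_frame hz k).differentiableAt_infty
  have hXd := fun k ↦ (hf.contDiffAt_push hz k).differentiableAt_infty
  have hhd : ∀ k, DifferentiableAt ℝ (fun y ↦ hess G f y (ε k y) (ε k y)) z := fun k ↦
    hf.riemannian.differentiableAt_hess hO (hf.contDiffAt hz) (hεd k) (hεd k)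
  have hid : ∀ k l, DifferentiableAt ℝ (fun y ↦ G (f y) (hess G f y (ε k y) (ε k y))
      (frame f ε y l)) z := fun k l ↦
    hf.riemannian.differentiableAt_inner hO hfd (hhd k) (hXd l)
  have hsd : ∀ k l, DifferentiableAt ℝ (fun y ↦ G (f y) (hess G f y (ε k y) (ε k y))
      (frame f ε y l) • frame f ε y l) z := fun k l ↦ (hid k l).fun_smul (hXd l)
  have h1 : meanCurvCoord G f =ᶠ[𝓝 z] fun y ↦ ∑ k, (hess G f y (ε k y) (ε k y)
      - ∑ l, G (f y) (hess G f y (ε k y) (ε k y)) (frame f ε y l) • frame f ε y l) :=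
    hf.eventually (fun y hy ↦ hf.meanCurvCoord_eq hy) hz
  rw [cov_congr h1, cov_sum fun k _ ↦ (hhd k).fun_sub (DifferentiableAt.fun_sum fun l _ ↦ hsd k l)]
  -- A derivative that falls on a tangential coefficient leaves a multiple of X_l, which the normal
  -- projection kills. Derivatives of X_l contribute the Hessian of f with an induced Christoffel
  -- vector, and derivatives of ε contribute the skew sum removed below.
  have h2 : ∀ k, nor (G (f z)) (frame f ε z) (cov G f (fun y ↦ hess G f y (ε k y) (ε k y)
      - ∑ l, G (f y) (hess G f y (ε k y) (ε k y)) (frame f ε y l) • frame f ε y l) z w)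
      = nor (G (f z)) (frame f ε z) (covHess G f z w (ε k z) (ε k z)
          - (2 : ℝ) • hess G f z (ε k z) (christoffelL (inducedMetric G f) z w (ε k z))
          - hess G f z w (christoffelL (inducedMetric G f) z (ε k z) (ε k z)))
        + (2 : ℝ) • ∑ l, G (f z) (cov G f (fun z ↦ frame f ε z k) z w) (frame f ε z l)
          • nor (G (f z)) (frame f ε z) (hess G f z (ε k z) (ε l z)) := fun k ↦ by
    rw [cov_sub (hhd k) (DifferentiableAt.fun_sum fun l _ ↦ hsd k l),
      cov_sum fun l _ ↦ hsd k l, hf.riemannian.cov_hess hO (hf.contDiffAt hz) (hεd k) (hεd k),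
      hess_symm hf.riemannian hO (hf.contDiffAt hz) (fderiv ℝ (ε k) z w),
      hf.hess_fderiv_frame hz]
    simp only [← norL_apply, map_add, map_sub, map_neg, map_sum, map_smul,
      fun l ↦ cov_smul (G := G) (f := f) (hid k l) (hXd l) w]
    simp only [norL_apply, nor_self (hf.orthonormal z hz), smul_zero, add_zero,
      hf.nor_cov_frame hz]
    -- By the Gauss formula the tangential coefficients of the Hessian are the frame coefficients of
    -- the induced Christoffel vector.
    have h3 : ∑ l, G (f z) (hess G f z (ε k z) (ε k z)) (frame f ε z l)
        • nor (G (f z)) (frame f ε z) (hess G f z w (ε l z))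
        = nor (G (f z)) (frame f ε z)
          (hess G f z w (christoffelL (inducedMetric G f) z (ε k z) (ε k z))) := by
      have h4 := eq_sum_of_orthonormal (hf.isRiemannianOn_inducedMetric.pos z hz)
        (hf.inducedMetric_orthonormal hz) (by simp)
        (christoffelL (inducedMetric G f) z (ε k z) (ε k z))
      conv_rhs => rw [h4]
      simp only [hess, map_sum, map_smul, ← norL_apply, ← smul_add, ← Finset.sum_add_distrib]
      refine Finset.sum_congr rfl fun l _ ↦ ?_
      congr 1
      change _ = G (f z) (fderiv ℝ f z _) (frame f ε z l)
      have h5 := congrArg (fun Y ↦ G (f z) Y (frame f ε z l))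
        (hf.hess_eq hz (ε k z) (ε k z))
      simp only [map_add, add_apply, inner_nor (hf.orthonormal z hz), zero_add] at h5
      exact h5
    rw [h3]
    module
  rw [← norL_apply, ← norL_apply, map_sum, map_sum]
  simp only [norL_apply, h2]
  rw [Finset.sum_add_distrib, add_eq_left, ← Finset.smul_sum]
  -- A skew matrix contracted with the symmetric Hessian: the sum equals its own negative.
  have h6 : ∑ k, ∑ l, G (f z) (cov G f (fun z ↦ frame f ε z k) z w) (frame f ε z l)
          • nor (G (f z)) (frame f ε z) (hess G f z (ε k z) (ε l z))
      = - ∑ k, ∑ l, G (f z) (cov G f (fun z ↦ frame f ε z k) z w) (frame f ε z l)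
          • nor (G (f z)) (frame f ε z) (hess G f z (ε k z) (ε l z)) := by
    conv_rhs => rw [Finset.sum_comm]
    simp only [← Finset.sum_neg_distrib]
    refine Finset.sum_congr rfl fun k _ ↦ Finset.sum_congr rfl fun l _ ↦ ?_
    rw [hf.inner_cov_frame_skew hz, hess_symm hf.riemannian hO (hf.contDiffAt hz) (ε k z),
      neg_smul]
  rw [two_smul]
  nth_rewrite 1 [h6]
  exact neg_add_cancel _

end FramedImmersion

end SecondOrder

/-! ### Time derivative of the form and Simons-type identity -/

section Evolution

variable {E : Type*} [NormedAddCommGroup E] [NormedSpace ℝ E] [FiniteDimensional ℝ E]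
  {G : E → E →L[ℝ] E →L[ℝ] ℝ} {O : Set E} {n m : ℕ}
  {W : Set (EuclideanSpace ℝ (Fin n))} {η : E → E [⋀^Fin n]→L[ℝ] ℝ}

/-- The time derivative of a parallel form evaluated on an orthonormal frame of a moving
immersion. -/
lemma hasDerivWithinAt_form_of_velocity {f : ℝ → EuclideanSpace ℝ (Fin n) → E}
    {ε : Fin n → ℝ → EuclideanSpace ℝ (Fin n) → EuclideanSpace ℝ (Fin n)} {J : Set ℝ} {t : ℝ}
    (htJ : t ∈ J) (hJ : UniqueDiffWithinAt ℝ J t)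
    (hf : FramedImmersion G O (f t) W fun i ↦ ε i t)
    {z : EuclideanSpace ℝ (Fin n)} (hz : z ∈ W) (hη : IsParallelOn G O η)
    (hd : ∀ p ∈ O, DifferentiableAt ℝ η p) {H : EuclideanSpace ℝ (Fin n) → E}
    (hγ : HasDerivWithinAt (fun s ↦ f s z) (H z) J t)
    {ε' : Fin n → EuclideanSpace ℝ (Fin n)}
    (hX : ∀ i, HasDerivWithinAt (fun s ↦ frame (f s) (fun i ↦ ε i s) z i)
      (fderiv ℝ H z (ε i t z) + fderiv ℝ (f t) z (ε' i)) J t)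
    (hon : ∀ᶠ s in 𝓝[J] t, ∀ i j, G (f s z) (frame (f s) (fun i ↦ ε i s) z i)
      (frame (f s) (fun i ↦ ε i s) z j) = if i = j then 1 else 0) :
    HasDerivWithinAt (fun s ↦ η (f s z) (frame (f s) (fun i ↦ ε i s) z))
      (∑ i, η (f t z) (update (frame (f t) (fun i ↦ ε i t) z) i
        (nor (G (f t z)) (frame (f t) (fun i ↦ ε i t) z) (cov G (f t) H z (ε i t z))))) J t := by
  have hO := hf.mapsTo z hz
  -- Torsion-freeness in the form ∇_t dF(e_i) = ∇_{e_i} ∂_t F + dF(∂_t e_i).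
  have hcov : ∀ i, fderiv ℝ H z (ε i t z) + fderiv ℝ (f t) z (ε' i)
      + christoffelL G (f t z) (H z) (frame (f t) (fun i ↦ ε i t) z i)
      = cov G (f t) H z (ε i t z) + fderiv ℝ (f t) z (ε' i) := fun i ↦ by
    rw [cov, hf.riemannian.christoffelL_symm hO (H z), frame]
    abel
  have h1 := hη.hasDerivWithinAt (t := t) (γ := fun s ↦ f s z) hO (hd _ hO) hγ hX
  refine h1.congr_deriv (Finset.sum_congr rfl fun i _ ↦ ?_)
  change η (f t z) (update (frame (f t) (fun i ↦ ε i t) z) i _) = _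
  have h2 := hf.riemannian.hasDerivWithinAt_inner (t := t) (γ := fun s ↦ f s z) hO hγ (hX i) (hX i)
  have h3 : HasDerivWithinAt (fun s ↦ G (f s z) (frame (f s) (fun i ↦ ε i s) z i)
      (frame (f s) (fun i ↦ ε i s) z i)) 0 J t := by
    refine (hasDerivWithinAt_const t J (1 : ℝ)).congr_of_eventuallyEq ?_ ?_
    · filter_upwards [hon] with s hs
      simp [hs]
    · have := hon.self_of_nhdsWithin htJ i i
      simpa using this
  -- The squared length of X_i is constantly 1, so ∇_t X_i has no component along X_i. Unique
  -- differentiability permits comparing derivatives within J even at an endpoint.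
  have h4 := hJ.eq_deriv _ h2 h3
  simp only [hcov] at h4 ⊢
  rw [hf.riemannian.symm _ hO (frame (f t) (fun i ↦ ε i t) z i)] at h4
  rw [hf.map_update_eq_nor hz, nor_add, hf.nor_fderiv hz]
  rw [show G (f t z) (cov G (f t) H z (ε i t z) + fderiv ℝ (f t) z (ε' i))
    (frame (f t) (fun i ↦ ε i t) z i) = 0 by linarith]
  simp

variable {f : EuclideanSpace ℝ (Fin n) → E}
  {ε : Fin n → EuclideanSpace ℝ (Fin n) → EuclideanSpace ℝ (Fin n)}

lemma sum_nor_update_update (p q : Fin n) (hpq : p ≠ q) (X : Fin n → E)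
    (h k : Fin m → ℝ) (ν : Fin m → E) (η₀ : E [⋀^Fin n]→L[ℝ] ℝ) :
    η₀ (update (update X p (∑ α, h α • ν α)) q (∑ β, k β • ν β))
      = ∑ α, ∑ β, η₀ (update (update X p (ν α)) q (ν β)) * h α * k β := by
  change η₀.toAlternatingMap _ = _
  rw [AlternatingMap.map_update_sum, Finset.sum_comm]
  refine Finset.sum_congr rfl fun β _ ↦ ?_
  rw [AlternatingMap.map_update_smul, update_comm hpq, AlternatingMap.map_update_sum,
    Finset.smul_sum]
  refine Finset.sum_congr rfl fun α _ ↦ ?_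
  rw [AlternatingMap.map_update_smul, update_comm hpq, smul_eq_mul, smul_eq_mul]
  change _ = η₀.toAlternatingMap _ * _ * _
  ring

/-- Simons' identity for a parallel form evaluated on an orthonormal frame. -/
lemma FramedImmersion.sum_cov_meanCurvCoord (hf : FramedImmersion G O f W ε)
    {z : EuclideanSpace ℝ (Fin n)} (hz : z ∈ W) (hη : IsParallelOn G O η)
    (hd : ∀ p ∈ O, DifferentiableAt ℝ η p) (hdim : Module.finrank ℝ E = n + m)
    {ν : Fin m → E} (hν : ∀ α β, G (f z) (ν α) (ν β) = if α = β then 1 else 0)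
    (hνX : ∀ α i, G (f z) (ν α) (frame f ε z i) = 0) :
    ∑ i, η (f z) (update (frame f ε z) i
        (nor (G (f z)) (frame f ε z) (cov G f (meanCurvCoord G f) z (ε i z))))
      = laplacianCoord (inducedMetric G f) (fun z ↦ η (f z) (frame f ε z)) z
        + η (f z) (frame f ε z) * ∑ α, ∑ i, ∑ k,
          G (f z) (secondFundCoord G f z (ε i z) (ε k z)) (ν α) ^ 2
        - 2 * ∑ p, ∑ q with p < q, ∑ α, ∑ β, ∑ k,
          η (f z) (update (update (frame f ε z) p (ν α)) q (ν β))
            * G (f z) (secondFundCoord G f z (ε p z) (ε k z)) (ν α)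
            * G (f z) (secondFundCoord G f z (ε q z) (ε k z)) (ν β)
        - ∑ i, ∑ α, ∑ k, η (f z) (update (frame f ε z) i (ν α))
          * G (f z) (curvatureCoord G (f z) (ν α) (frame f ε z k) (frame f ε z i))
            (frame f ε z k) := by
  have hO := hf.mapsTo z hz
  have hsymm := hf.riemannian.symm _ hO
  have hnor := nor_eq_sum_normal hsymm (hf.riemannian.pos _ hO) (hf.orthonormal z hz) hν hνX hdim
  set A : Fin n → Fin n → E :=
    fun k i ↦ nor (G (f z)) (frame f ε z) (hess G f z (ε k z) (ε i z)) with hA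
  have hAsymm : ∀ i k, secondFundCoord G f z (ε i z) (ε k z) = A k i := fun i k ↦ by
    rw [hf.secondFundCoord_eq hz, hess_symm hf.riemannian hO (hf.contDiffAt hz)]
  have hinner : ∀ Y α, G (f z) (nor (G (f z)) (frame f ε z) Y) (ν α) = G (f z) Y (ν α) :=
    fun Y α ↦ by simp [hnor, hν]
  have hAsum : ∀ k i, A k i = ∑ α, G (f z) (A k i) (ν α) • ν α := fun k i ↦ by
    simp only [hA, hinner]
    exact hnor _
  simp only [hAsymm]
  rw [hf.laplacianCoord_form hz hη hd]
  have hH : ∀ i, η (f z) (update (frame f ε z) i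
      (nor (G (f z)) (frame f ε z) (cov G f (meanCurvCoord G f) z (ε i z))))
      = ∑ k, (η (f z) (update (frame f ε z) i (nor (G (f z)) (frame f ε z)
            (covHess G f z (ε k z) (ε k z) (ε i z)
            - (2 : ℝ) • hess G f z (ε k z)
              (christoffelL (inducedMetric G f) z (ε k z) (ε i z))
            - hess G f z (christoffelL (inducedMetric G f) z (ε k z) (ε k z)) (ε i z))))
          - ∑ α, η (f z) (update (frame f ε z) i (ν α))
          * G (f z) (curvatureCoord G (f z) (ν α) (frame f ε z k) (frame f ε z i))
            (frame f ε z k)) := fun i ↦ by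
    -- The Codazzi equation produces ⟨R(X_k, X_i) X_k, ν_α⟩. Pair symmetry followed by both skew
    -- symmetries turns it into ⟨R(ν_α, X_k) X_i, X_k⟩, which is R_{αkki} in the stated convention.
    have hR : ∀ k, ∑ α, η (f z) (update (frame f ε z) i (ν α))
          * G (f z) (curvatureCoord G (f z) (ν α) (frame f ε z k) (frame f ε z i))
            (frame f ε z k)
        = η (f z) (update (frame f ε z) i (nor (G (f z)) (frame f ε z)
          (curvatureCoord G (f z) (frame f ε z k) (frame f ε z i) (frame f ε z k)))) := fun k ↦ by
      rw [hnor]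
      change _ = (η (f z)).toAlternatingMap _
      rw [AlternatingMap.map_update_sum]
      refine Finset.sum_congr rfl fun α _ ↦ ?_
      rw [AlternatingMap.map_update_smul, smul_eq_mul, mul_comm]
      congr 1
      rw [hf.riemannian.curvatureCoord_pair_symm hO (frame f ε z k),
        IsRiemannianOn.curvatureCoord_antisymm G (f z) (ν α), map_neg, neg_apply]
      have := hf.riemannian.curvatureCoord_skew hO (frame f ε z k) (ν α) (frame f ε z k)
        (frame f ε z i)
      rw [hsymm (frame f ε z k)] at this
      linarith
    rw [hf.nor_cov_meanCurvCoord hz, ← norL_apply, map_sum]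
    change (η (f z)).toAlternatingMap _ = _
    rw [AlternatingMap.map_update_sum]
    refine Finset.sum_congr rfl fun k _ ↦ ?_
    rw [hR, ← ContinuousAlternatingMap.map_update_sub]
    change η (f z) _ = _
    rw [← norL_apply, ← norL_apply, ← map_sub]
    congr 3
    -- The Laplacian carries the third derivative in the order (k, k, i), equal to (k, i, k), and
    -- the derivative of H carries (i, k, k). The exchange of the outer two is the Ricci identity;
    -- the Christoffel corrections on the two sides agree by symmetry.
    have h1 := hf.riemannian.covHess_sub hO (hf.contDiffAt hz) (ε k z) (ε i z) (ε k z)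
    rw [hf.covHess_symm hz (ε k z) (ε k z) (ε i z), frame, frame, ← h1,
      hf.isRiemannianOn_inducedMetric.christoffelL_symm hz (ε i z),
      hess_symm hf.riemannian hO (hf.contDiffAt hz) (ε i z)]
    abel
  have hsq : ∑ k, ∑ i, G (f z) (A k i) (A k i)
      = ∑ α, ∑ i, ∑ k, G (f z) (A k i) (ν α) ^ 2 := by
    have h : ∀ k i, G (f z) (A k i) (A k i) = ∑ α, G (f z) (A k i) (ν α) ^ 2 := fun k i ↦ by
      conv_lhs => enter [2]; rw [hAsum]
      simp [sq]
    simp only [h]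
    rw [Finset.sum_comm' (s := Finset.univ) (t := fun _ ↦ Finset.univ) (t' := Finset.univ)
      (s' := fun _ ↦ Finset.univ) (by simp)]
    rw [Finset.sum_comm (s := Finset.univ (α := Fin m))]
    exact Finset.sum_congr rfl fun i _ ↦ Finset.sum_comm
  have hpair : ∑ k, (∑ i, ∑ j, if i = j then 0 else
        η (f z) (update (update (frame f ε z) i (A k i)) j (A k j)))
      = 2 * ∑ p, ∑ q with p < q, ∑ α, ∑ β, ∑ k,
          η (f z) (update (update (frame f ε z) p (ν α)) q (ν β))
            * G (f z) (A k p) (ν α) * G (f z) (A k q) (ν β) := by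
    rw [Finset.sum_congr rfl fun k _ ↦ sum_ne_eq_two_mul
      (fun i j ↦ η (f z) (update (update (frame f ε z) i (A k i)) j (A k j))) ?_]
    · rw [← Finset.mul_sum, Finset.sum_comm]
      congr 1
      refine Finset.sum_congr rfl fun p _ ↦ ?_
      rw [Finset.sum_comm]
      refine Finset.sum_congr rfl fun q hq ↦ ?_
      have hpq : p ≠ q := (Finset.mem_filter.1 hq).2.ne
      rw [Finset.sum_congr rfl fun k _ ↦ ?_, Finset.sum_comm]
      · exact Finset.sum_congr rfl fun α _ ↦ Finset.sum_comm
      · conv_lhs => rw [hAsum k p, hAsum k q]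
        exact sum_nor_update_update p q hpq _ _ _ _ _
    · intro i j hij
      rw [update_comm hij]
  rw [Finset.sum_congr rfl fun i _ ↦ hH i, ← hsq, ← hpair]
  have hcurv : ∑ i, ∑ α, ∑ k, η (f z) (update (frame f ε z) i (ν α))
          * G (f z) (curvatureCoord G (f z) (ν α) (frame f ε z k) (frame f ε z i))
            (frame f ε z k) = ∑ i, ∑ k, ∑ α, η (f z) (update (frame f ε z) i (ν α))
          * G (f z) (curvatureCoord G (f z) (ν α) (frame f ε z k) (frame f ε z i))
            (frame f ε z k) := Finset.sum_congr rfl fun i _ ↦ Finset.sum_comm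
  rw [hcurv]
  simp only [Finset.sum_add_distrib, Finset.sum_sub_distrib, ← Finset.sum_mul, hA]
  rw [Finset.sum_comm (s := Finset.univ (α := Fin n)) (t := Finset.univ (α := Fin n))
    (f := fun i k ↦ η (f z) (update (frame f ε z) i (nor (G (f z)) (frame f ε z) _)))]
  ring

end Evolution

/-! ### Exchanging time and space derivatives on an interval with endpoints -/

section TimeDerivative

lemma interior_nonempty_of_ordConnected {J : Set ℝ} (hJ : J.OrdConnected) (hJ' : J.Nontrivial) :
    (interior J).Nonempty := by
  obtain ⟨a, ha, b, hb, hab⟩ := hJ'.exists_lt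
  obtain ⟨c, hc⟩ := Set.nonempty_Ioo.2 hab
  exact ⟨c, mem_interior.2 ⟨Set.Ioo a b, Set.Ioo_subset_Icc_self.trans (hJ.out ha hb), isOpen_Ioo,
    hc⟩⟩

lemma uniqueDiffOn_of_ordConnected {J : Set ℝ} (hJ : J.OrdConnected) (hJ' : J.Nontrivial) :
    UniqueDiffOn ℝ J :=
  uniqueDiffOn_convex (hJ.convex : Convex ℝ J) (interior_nonempty_of_ordConnected hJ hJ')

lemma subset_closure_interior_of_ordConnected {J : Set ℝ} (hJ : J.OrdConnected)
    (hJ' : J.Nontrivial) : J ⊆ closure (interior J) := by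
  rw [(hJ.convex : Convex ℝ J).closure_interior_eq_closure_of_nonempty_interior
    (interior_nonempty_of_ordConnected hJ hJ')]
  exact subset_closure

variable {E V : Type*} [NormedAddCommGroup E] [NormedSpace ℝ E] [NormedAddCommGroup V]
  [NormedSpace ℝ V] {J : Set ℝ} {W : Set V} {f : ℝ × V → E} {t : ℝ} {z : V}

/-- The spatial derivative of a function on `J × W`. -/
lemma hasFDerivAt_slice (hW : IsOpen W) (hf : DifferentiableOn ℝ f (J ×ˢ W)) (ht : t ∈ J)
    (hz : z ∈ W) :
    HasFDerivAt (fun y ↦ f (t, y))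
      ((fderivWithin ℝ f (J ×ˢ W) (t, z)).comp (ContinuousLinearMap.inr ℝ ℝ V)) z := by
  have h := ((hf (t, z) ⟨ht, hz⟩).hasFDerivWithinAt.comp z
    (hasFDerivAt_prodMk_right t z).hasFDerivWithinAt (s := W) fun y hy ↦ ⟨ht, hy⟩)
  exact h.hasFDerivAt (hW.mem_nhds hz)

/-- The time derivative of a function on `J × W`. -/
lemma hasDerivWithinAt_slice (hf : DifferentiableOn ℝ f (J ×ˢ W)) (ht : t ∈ J)
    (hz : z ∈ W) :
    HasDerivWithinAt (fun s ↦ f (s, z)) (fderivWithin ℝ f (J ×ˢ W) (t, z) (1, 0)) J t := by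
  have h : Set.MapsTo (fun s ↦ (s, z)) J (J ×ˢ W) := fun _ hs ↦ ⟨hs, hz⟩
  exact (hf (t, z) ⟨ht, hz⟩).hasFDerivWithinAt.comp_hasDerivWithinAt t
    ((hasDerivWithinAt_id t J).prodMk (hasDerivWithinAt_const t J z)) h

/-- Differentiation in time commutes with differentiation in space, also at an endpoint. -/
lemma hasDerivWithinAt_fderiv_apply (hJ : UniqueDiffOn ℝ J) (hJ' : J ⊆ closure (interior J))
    (hW : IsOpen W) (hf : ContDiffOn ℝ ∞ f (J ×ˢ W)) {b : ℝ × V → V}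
    (hb : DifferentiableOn ℝ b (J ×ˢ W)) (ht : t ∈ J) (hz : z ∈ W) {H : V → E}
    (hH : ∀ y ∈ W, HasDerivWithinAt (fun s ↦ f (s, y)) (H y) J t) :
    HasDerivWithinAt (fun s ↦ fderiv ℝ (fun y ↦ f (s, y)) z (b (s, z)))
      (fderiv ℝ H z (b (t, z)) + fderiv ℝ (fun y ↦ f (t, y)) z
        (fderivWithin ℝ b (J ×ˢ W) (t, z) (1, 0))) J t := by
  have hS : UniqueDiffOn ℝ (J ×ˢ W) := hJ.prod hW.uniqueDiffOn
  have hfd : DifferentiableOn ℝ f (J ×ˢ W) := hf.differentiableOn (by simp)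
  set D := fderivWithin ℝ f (J ×ˢ W) with hD
  have hDd : DifferentiableOn ℝ D (J ×ˢ W) :=
    (hf.fderivWithin hS (m := 1) (by norm_cast)).differentiableOn (by simp)
  have hslice : ∀ s ∈ J, ∀ v, fderiv ℝ (fun y ↦ f (s, y)) z v = D (s, z) (0, v) := fun s hs v ↦ by
    rw [(hasFDerivAt_slice hW hfd hs hz).fderiv]
    simp [hD]
  have hHD : ∀ y ∈ W, H y = D (t, y) (1, 0) := fun y hy ↦
    (hJ t ht).eq_deriv _ (hH y hy) (hasDerivWithinAt_slice hfd ht hy)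
  have h1 : HasDerivWithinAt (fun s ↦ D (s, z) (0, b (s, z))) _ J t :=
    (hasDerivWithinAt_slice hDd ht hz).clm_apply
      ((hasDerivWithinAt_const t J (0 : ℝ)).prodMk (hasDerivWithinAt_slice hb ht hz))
  have h2 : fderiv ℝ H z (b (t, z)) = fderivWithin ℝ D (J ×ˢ W) (t, z) (0, b (t, z)) (1, 0) := by
    have h3 : H =ᶠ[𝓝 z] fun y ↦ D (t, y) (1, 0) := by
      filter_upwards [hW.mem_nhds hz] with y hy using hHD y hy
    rw [h3.fderiv_eq, ((hasFDerivAt_slice hW hDd ht hz).clm_apply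
      (hasFDerivAt_const ((1, 0) : ℝ × V) z)).fderiv]
    simp
  -- Second derivatives within a set are symmetric at points in the closure of its interior, which
  -- includes the endpoints of a nondegenerate interval.
  have hsymm : fderivWithin ℝ D (J ×ˢ W) (t, z) (0, b (t, z)) (1, 0)
      = fderivWithin ℝ D (J ×ˢ W) (t, z) (1, 0) (0, b (t, z)) := by
    refine ((hf (t, z) ⟨ht, hz⟩).isSymmSndFDerivWithinAt (by simpa using two_le_infty) hS ?_
      ⟨ht, hz⟩).eq _ _
    rw [interior_prod_eq, closure_prod_eq, hW.interior_eq]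
    exact ⟨hJ' ht, subset_closure hz⟩
  rw [h2, hsymm, hslice t ht]
  exact h1.congr (fun s hs ↦ hslice s hs _) (hslice t ht _)

end TimeDerivative

/-! ### Metric, form, map and frame read in charts -/

section Charts

variable {d n : ℕ} {M : Type*} [TopologicalSpace M] [ChartedSpace (EuclideanSpace ℝ (Fin d)) M]
  [IsManifold (𝓡 d) ∞ M] {φ : OpenPartialHomeomorph M (EuclideanSpace ℝ (Fin d))}

lemma mdifferentiable_chart (hφ : φ ∈ IsManifold.maximalAtlas (𝓡 d) ∞ M) :
    φ.MDifferentiable (𝓡 d) (𝓡 d) :=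
  ⟨(contMDiffOn_of_mem_maximalAtlas hφ).mdifferentiableOn (by simp),
    (contMDiffOn_symm_of_mem_maximalAtlas hφ).mdifferentiableOn (by simp)⟩

lemma ofChart_toChart (hφ : φ ∈ IsManifold.maximalAtlas (𝓡 d) ∞ M) {y : M} (hy : y ∈ φ.source)
    (v : EuclideanSpace ℝ (Fin d)) :
    (ofChart φ (φ y) (toChart φ y v) : EuclideanSpace ℝ (Fin d)) = v :=
  DFunLike.congr_fun ((mdifferentiable_chart hφ).symm_comp_deriv hy) v

lemma toChart_ofChart (hφ : φ ∈ IsManifold.maximalAtlas (𝓡 d) ∞ M)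
    {z : EuclideanSpace ℝ (Fin d)} (hz : z ∈ φ.target) (v : EuclideanSpace ℝ (Fin d)) :
    toChart φ (φ.symm z) (ofChart φ z v) = v :=
  DFunLike.congr_fun ((mdifferentiable_chart hφ).comp_symm_deriv hz) v

lemma ofChart_injective (hφ : φ ∈ IsManifold.maximalAtlas (𝓡 d) ∞ M)
    {z : EuclideanSpace ℝ (Fin d)} (hz : z ∈ φ.target) : Injective (ofChart φ z) :=
  LeftInverse.injective (toChart_ofChart hφ hz)

lemma toChart_injective (hφ : φ ∈ IsManifold.maximalAtlas (𝓡 d) ∞ M) {y : M}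
    (hy : y ∈ φ.source) : Injective (toChart φ y) :=
  LeftInverse.injective (ofChart_toChart hφ hy)

lemma metricInChart_toChart (g : Metric d M) (hφ : φ ∈ IsManifold.maximalAtlas (𝓡 d) ∞ M) {y : M}
    (hy : y ∈ φ.source) (X Y : TangentSpace (𝓡 d) y) :
    metricInChart g φ (φ y) (toChart φ y X) (toChart φ y Y) = g.inner y X Y := by
  -- The point φ.symm (φ y) equals y only propositionally. Since all tangent spaces are the model
  -- space by definition, the base point can be varied while the vectors stay fixed.
  have h : ∀ y', y' = y → ∀ v w : EuclideanSpace ℝ (Fin d),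
      g.inner y' v w = g.inner y v w := by rintro _ rfl _ _; rfl
  have h1 := h _ (φ.left_inv hy) (ofChart φ (φ y) (toChart φ y X)) (ofChart φ (φ y) (toChart φ y Y))
  exact h1.trans (congrArg₂ (fun v w : EuclideanSpace ℝ (Fin d) ↦ g.inner y v w)
    (ofChart_toChart hφ hy X) (ofChart_toChart hφ hy Y))

lemma formInChart_toChart (Ω : ∀ y : M, TangentSpace (𝓡 d) y [⋀^Fin n]→L[ℝ] ℝ)
    (hφ : φ ∈ IsManifold.maximalAtlas (𝓡 d) ∞ M) {y : M} (hy : y ∈ φ.source)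
    (X : Fin n → TangentSpace (𝓡 d) y) :
    formInChart Ω φ (φ y) (fun i ↦ toChart φ y (X i)) = Ω y X := by
  have h : ∀ y', y' = y → ∀ v : Fin n → EuclideanSpace ℝ (Fin d),
      Ω y' v = Ω y v := by rintro _ rfl _; rfl
  refine (h _ (φ.left_inv hy) (fun i ↦ ofChart φ (φ y) (toChart φ y (X i)))).trans ?_
  congr 1
  ext1 i
  exact ofChart_toChart hφ hy (X i)

/-- This coordinate vector field is the image of a constant section under the tangent map of φ.symm,
hence smooth. -/
lemma contMDiffOn_ofChart (hφ : φ ∈ IsManifold.maximalAtlas (𝓡 d) ∞ M)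
    (v : EuclideanSpace ℝ (Fin d)) :
    ContMDiffOn (𝓡 d) (𝓡 d).tangent ∞
      (fun z ↦ (⟨φ.symm z, ofChart φ z v⟩ : TangentBundle (𝓡 d) M)) φ.target := by
  have : IsManifold (𝓡 d) 1 M := IsManifold.of_le (n := ∞) (by simp)
  have h1 := (contMDiffOn_symm_of_mem_maximalAtlas hφ).contMDiffOn_tangentMapWithin (m := ∞)
    (by simp) φ.open_target.uniqueMDiffOn
  have h2 : ContMDiffOn (𝓡 d) (𝓡 d).tangent ∞
      (fun z ↦ (⟨z, v⟩ : TangentBundle (𝓡 d) (EuclideanSpace ℝ (Fin d)))) φ.target :=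
    contMDiffOn_vectorSpace_iff_contDiffOn.2 contDiffOn_const
  refine (h1.comp h2 fun z hz ↦ hz).congr fun z hz ↦ ?_
  simp only [comp_apply, tangentMapWithin, mfderivWithin_of_isOpen φ.open_target hz]
  rfl

lemma contDiffOn_metricInChart_apply (g : Metric d M)
    (hφ : φ ∈ IsManifold.maximalAtlas (𝓡 d) ∞ M) (v w : EuclideanSpace ℝ (Fin d)) :
    ContDiffOn ℝ ∞ (fun z ↦ metricInChart g φ z v w) φ.target := by
  rw [← contMDiffOn_iff_contDiffOn]
  intro z hz
  have h : ContMDiffWithinAt (𝓡 d) ((𝓡 d).prod 𝓘(ℝ, ℝ)) ∞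
      (fun z ↦ Bundle.TotalSpace.mk' ℝ (E := Bundle.Trivial M ℝ) (φ.symm z)
        (g.inner (φ.symm z) (ofChart φ z v) (ofChart φ z w))) φ.target z := by
    apply ContMDiffWithinAt.clm_bundle_apply₂ (F₁ := EuclideanSpace ℝ (Fin d))
      (F₂ := EuclideanSpace ℝ (Fin d))
    · exact g.contMDiff.contMDiffAt.comp_contMDiffWithinAt z
        (contMDiffOn_symm_of_mem_maximalAtlas hφ z hz)
    · exact contMDiffOn_ofChart hφ v z hz
    · exact contMDiffOn_ofChart hφ w z hz
  rw [Bundle.contMDiffWithinAt_totalSpace] at h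
  exact h.2

lemma isRiemannianOn_metricInChart (g : Metric d M)
    (hφ : φ ∈ IsManifold.maximalAtlas (𝓡 d) ∞ M) :
    IsRiemannianOn (metricInChart g φ) φ.target where
  isOpen := φ.open_target
  contDiffOn := contDiffOn_clm_apply.2 fun v ↦ contDiffOn_clm_apply.2 fun w ↦
    contDiffOn_metricInChart_apply g hφ v w
  symm p _ v w := g.symm (φ.symm p) (ofChart φ p v) (ofChart φ p w)
  pos p hp v hv := g.pos (φ.symm p) (ofChart φ p v) fun h ↦
    hv (ofChart_injective hφ hp (h.trans (map_zero (ofChart φ p)).symm))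

lemma isParallelOn_formInChart {g : Metric d M}
    {Ω : ∀ y : M, TangentSpace (𝓡 d) y [⋀^Fin n]→L[ℝ] ℝ} (hΩ : IsParallelForm g Ω)
    (hφ : φ ∈ IsManifold.maximalAtlas (𝓡 d) ∞ M) :
    IsParallelOn (metricInChart g φ) φ.target (formInChart Ω φ) := fun p hp v w ↦ by
  simpa only [christoffelL_apply] using sub_eq_zero.1 (hΩ φ hφ p hp v w)

variable {N : Type*} [TopologicalSpace N] [ChartedSpace (EuclideanSpace ℝ (Fin n)) N]
  [IsManifold (𝓡 n) ∞ N] {ψ : OpenPartialHomeomorph N (EuclideanSpace ℝ (Fin n))}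

/-- Chain rule on both sides of (φ ∘ f ∘ ψ⁻¹) ∘ ψ = φ ∘ f, which holds near y. -/
lemma fderiv_mapInCharts (hφ : φ ∈ IsManifold.maximalAtlas (𝓡 d) ∞ M)
    (hψ : ψ ∈ IsManifold.maximalAtlas (𝓡 n) ∞ N) {f : N → M} {y : N} (hy : y ∈ ψ.source)
    (hfy : f y ∈ φ.source) (hf : MDifferentiableAt (𝓡 n) (𝓡 d) f y)
    (v : TangentSpace (𝓡 n) y) :
    fderiv ℝ (mapInCharts φ ψ f) (ψ y) (toChart ψ y v)
      = toChart φ (f y) (mfderiv (𝓡 n) (𝓡 d) f y v) := by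
  have h1 := (mdifferentiable_chart hφ).mdifferentiableAt hfy
  have h2 := (mdifferentiable_chart hψ).mdifferentiableAt hy
  have h3 := (mdifferentiable_chart hψ).mdifferentiableAt_symm (ψ.map_source hy)
  have h4 : MDifferentiableAt (𝓡 n) (𝓡 d) (mapInCharts φ ψ f) (ψ y) := by
    have h5 : MDifferentiableAt (𝓡 n) (𝓡 d) (φ ∘ f) (ψ.symm (ψ y)) := by
      rw [ψ.left_inv hy]
      exact h1.comp y hf
    exact h5.comp (ψ y) h3
  have h6 : mapInCharts φ ψ f ∘ ψ =ᶠ[𝓝 y] φ ∘ f := by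
    filter_upwards [ψ.open_source.mem_nhds hy] with x hx
    simp [mapInCharts, ψ.left_inv hx]
  have h7 := h6.mfderiv_eq (I := 𝓡 n) (I' := 𝓡 d)
  rw [mfderiv_comp y h4 h2, mfderiv_comp y h1 hf, mfderiv_eq_fderiv] at h7
  exact DFunLike.congr_fun h7 v

lemma contDiffOn_mapInCharts {J : Set ℝ} {F : ℝ → N → M}
    (hφ : φ ∈ IsManifold.maximalAtlas (𝓡 d) ∞ M)
    (hψ : ψ ∈ IsManifold.maximalAtlas (𝓡 n) ∞ N)
    (hF : ContMDiffOn (𝓘(ℝ, ℝ).prod (𝓡 n)) (𝓡 d) ∞ (fun p : ℝ × N ↦ F p.1 p.2)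
      (J ×ˢ Set.univ)) {S : Set (ℝ × EuclideanSpace ℝ (Fin n))}
    (hS : ∀ p ∈ S, p.1 ∈ J ∧ p.2 ∈ ψ.target ∧ F p.1 (ψ.symm p.2) ∈ φ.source) :
    ContDiffOn ℝ ∞ (fun p : ℝ × EuclideanSpace ℝ (Fin n) ↦ mapInCharts φ ψ (F p.1) p.2) S := by
  rw [← contMDiffOn_iff_contDiffOn]
  have h1 : ContMDiffOn 𝓘(ℝ, ℝ × EuclideanSpace ℝ (Fin n)) (𝓘(ℝ, ℝ).prod (𝓡 n)) ∞
      (fun p : ℝ × EuclideanSpace ℝ (Fin n) ↦ ((p.1, ψ.symm p.2) : ℝ × N)) S :=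
    contDiff_fst.contMDiff.contMDiffOn.prodMk
      ((contMDiffOn_symm_of_mem_maximalAtlas hψ).comp contDiff_snd.contMDiff.contMDiffOn
      fun p hp ↦ (hS p hp).2.1)
  exact (contMDiffOn_of_mem_maximalAtlas hφ).comp (hF.comp h1 fun p hp ↦ ⟨(hS p hp).1, trivial⟩)
    fun p hp ↦ (hS p hp).2.2

lemma contDiffOn_toChart {J : Set ℝ} {U : Set (ℝ × N)} {e : ℝ → ∀ x : N, TangentSpace (𝓡 n) x}
    (hψ : ψ ∈ IsManifold.maximalAtlas (𝓡 n) ∞ N)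
    (he : ContMDiffOn (𝓘(ℝ, ℝ).prod (𝓡 n)) (𝓡 n).tangent ∞
      (fun p : ℝ × N ↦ (⟨p.2, e p.1 p.2⟩ : TangentBundle (𝓡 n) N)) (U ∩ J ×ˢ Set.univ))
    {S : Set (ℝ × EuclideanSpace ℝ (Fin n))}
    (hS : ∀ p ∈ S, p.1 ∈ J ∧ p.2 ∈ ψ.target ∧ (p.1, ψ.symm p.2) ∈ U) :
    ContDiffOn ℝ ∞ (fun p : ℝ × EuclideanSpace ℝ (Fin n) ↦
      toChart ψ (ψ.symm p.2) (e p.1 (ψ.symm p.2))) S := by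
  have : IsManifold (𝓡 n) 1 N := IsManifold.of_le (n := ∞) (by simp)
  rw [← contMDiffOn_iff_contDiffOn]
  have h1 : ContMDiffOn 𝓘(ℝ, ℝ × EuclideanSpace ℝ (Fin n)) (𝓘(ℝ, ℝ).prod (𝓡 n)) ∞
      (fun p : ℝ × EuclideanSpace ℝ (Fin n) ↦ ((p.1, ψ.symm p.2) : ℝ × N)) S :=
    contDiff_fst.contMDiff.contMDiffOn.prodMk
      ((contMDiffOn_symm_of_mem_maximalAtlas hψ).comp contDiff_snd.contMDiff.contMDiffOn
      fun p hp ↦ (hS p hp).2.1)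
  have h2 := he.comp h1 fun p hp ↦ ⟨(hS p hp).2.2, (hS p hp).1, trivial⟩
  have h3 := (contMDiffOn_of_mem_maximalAtlas hψ).contMDiffOn_tangentMapWithin (m := ∞)
    (by simp) ψ.open_source.uniqueMDiffOn
  have h4 := (contMDiff_snd_tangentBundle_modelSpace (EuclideanSpace ℝ (Fin n))
    (𝓡 n) (n := ∞)).comp_contMDiffOn (h3.comp h2 fun p hp ↦ ψ.map_target (hS p hp).2.1)
  refine h4.congr fun p hp ↦ ?_
  exact (DFunLike.congr_fun (mfderivWithin_of_isOpen (I := 𝓡 n) (I' := 𝓡 n) (f := ψ)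
    ψ.open_source (ψ.map_target (hS p hp).2.1)) (e p.1 (ψ.symm p.2))).symm

end Charts

/-! ### The flow and its orthonormal frame in charts -/

section Flow

lemma laplacianCoord_congr {n : ℕ}
    (Λ : EuclideanSpace ℝ (Fin n) → EuclideanSpace ℝ (Fin n) →L[ℝ] EuclideanSpace ℝ (Fin n) →L[ℝ] ℝ)
    {u v : EuclideanSpace ℝ (Fin n) → ℝ} {z : EuclideanSpace ℝ (Fin n)} (h : u =ᶠ[𝓝 z] v) :
    laplacianCoord Λ u z = laplacianCoord Λ v z := by
  rw [laplacianCoord, laplacianCoord, h.fderiv_eq, h.fderiv.fderiv_eq]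

variable {d n : ℕ} {M : Type*} [TopologicalSpace M] [ChartedSpace (EuclideanSpace ℝ (Fin d)) M]
  [IsManifold (𝓡 d) ∞ M] {φ : OpenPartialHomeomorph M (EuclideanSpace ℝ (Fin d))}
  {N : Type*} [TopologicalSpace N] [ChartedSpace (EuclideanSpace ℝ (Fin n)) N]
  [IsManifold (𝓡 n) ∞ N] {ψ : OpenPartialHomeomorph N (EuclideanSpace ℝ (Fin n))}
  {g : Metric d M} {J : Set ℝ} {F : ℝ → N → M}

/-- The coordinate expression of the time-dependent frame `e` in the chart `ψ`. -/
def frameInChart (ψ : OpenPartialHomeomorph N (EuclideanSpace ℝ (Fin n)))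
    (e : Fin n → ℝ → ∀ x : N, TangentSpace (𝓡 n) x) (s : ℝ) (i : Fin n)
    (z : EuclideanSpace ℝ (Fin n)) : EuclideanSpace ℝ (Fin n) :=
  toChart ψ (ψ.symm z) (e i s (ψ.symm z))

lemma frameInChart_apply (e : Fin n → ℝ → ∀ x : N, TangentSpace (𝓡 n) x) (s : ℝ) (i : Fin n)
    {y : N} (hy : y ∈ ψ.source) : frameInChart ψ e s i (ψ y) = toChart ψ y (e i s y) := by
  have h : ∀ y', y' = y → (toChart ψ y' (e i s y') : EuclideanSpace ℝ (Fin n))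
      = toChart ψ y (e i s y) := by rintro _ rfl; rfl
  exact h _ (ψ.left_inv hy)

lemma IsMeanCurvatureFlow.mdifferentiableAt (hF : IsMeanCurvatureFlow n g J F) {s : ℝ}
    (hs : s ∈ J) (y : N) : MDifferentiableAt (𝓡 n) (𝓡 d) (F s) y := by
  have h : ContMDiffOn (𝓡 n) (𝓘(ℝ, ℝ).prod (𝓡 n)) ∞ (fun y : N ↦ ((s, y) : ℝ × N)) Set.univ :=
    contMDiffOn_const.prodMk contMDiffOn_id
  have h2 := hF.smooth.comp h fun _ _ ↦ ⟨hs, trivial⟩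
  exact (h2.contMDiffAt Filter.univ_mem).mdifferentiableAt (by simp)

lemma IsMeanCurvatureFlow.fderiv_mapInCharts (hF : IsMeanCurvatureFlow n g J F)
    (hφ : φ ∈ IsManifold.maximalAtlas (𝓡 d) ∞ M) (hψ : ψ ∈ IsManifold.maximalAtlas (𝓡 n) ∞ N)
    {s : ℝ} (hs : s ∈ J) {y : N} (hy : y ∈ ψ.source) (hFy : F s y ∈ φ.source)
    (v : TangentSpace (𝓡 n) y) :
    fderiv ℝ (mapInCharts φ ψ (F s)) (ψ y) (toChart ψ y v)
      = toChart φ (F s y) (mfderiv (𝓡 n) (𝓡 d) (F s) y v) :=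
  MCF.fderiv_mapInCharts hφ hψ hy hFy (hF.mdifferentiableAt hs y) v

lemma IsMeanCurvatureFlow.frame_eq (hF : IsMeanCurvatureFlow n g J F)
    (hφ : φ ∈ IsManifold.maximalAtlas (𝓡 d) ∞ M) (hψ : ψ ∈ IsManifold.maximalAtlas (𝓡 n) ∞ N)
    (e : Fin n → ℝ → ∀ x : N, TangentSpace (𝓡 n) x)
    {s : ℝ} (hs : s ∈ J) {y : N} (hy : y ∈ ψ.source) (hFy : F s y ∈ φ.source) :
    frame (mapInCharts φ ψ (F s)) (frameInChart ψ e s) (ψ y)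
      = fun i ↦ toChart φ (F s y) (pushFrame d F e s y i) := by
  ext1 i
  rw [frame, frameInChart_apply e s i hy, hF.fderiv_mapInCharts hφ hψ hs hy hFy]
  rfl

lemma mapInCharts_apply {f : N → M} {y : N} (hy : y ∈ ψ.source) :
    mapInCharts φ ψ f (ψ y) = φ (f y) := by
  rw [mapInCharts, ψ.left_inv hy]

lemma IsOrthonormalFrame.inner_frame {U : Set (ℝ × N)}
    {e : Fin n → ℝ → ∀ x : N, TangentSpace (𝓡 n) x} (he : IsOrthonormalFrame g J F U e)
    (hF : IsMeanCurvatureFlow n g J F)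
    (hφ : φ ∈ IsManifold.maximalAtlas (𝓡 d) ∞ M) (hψ : ψ ∈ IsManifold.maximalAtlas (𝓡 n) ∞ N)
    {s : ℝ} (hs : s ∈ J) {y : N} (hy : y ∈ ψ.source) (hFy : F s y ∈ φ.source) (hU : (s, y) ∈ U)
    (i j : Fin n) :
    metricInChart g φ (mapInCharts φ ψ (F s) (ψ y))
      (frame (mapInCharts φ ψ (F s)) (frameInChart ψ e s) (ψ y) i)
      (frame (mapInCharts φ ψ (F s)) (frameInChart ψ e s) (ψ y) j) = if i = j then 1 else 0 := by
  rw [hF.frame_eq hφ hψ e hs hy hFy, mapInCharts_apply hy]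
  exact (metricInChart_toChart g hφ hFy _ _).trans (he.orthonormal s hs y hU i j)

lemma IsMeanCurvatureFlow.form_eq (hF : IsMeanCurvatureFlow n g J F)
    (Ω : ∀ y : M, TangentSpace (𝓡 d) y [⋀^Fin n]→L[ℝ] ℝ)
    (hφ : φ ∈ IsManifold.maximalAtlas (𝓡 d) ∞ M) (hψ : ψ ∈ IsManifold.maximalAtlas (𝓡 n) ∞ N)
    (e : Fin n → ℝ → ∀ x : N, TangentSpace (𝓡 n) x)
    {s : ℝ} (hs : s ∈ J) {y : N} (hy : y ∈ ψ.source) (hFy : F s y ∈ φ.source) :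
    formInChart Ω φ (mapInCharts φ ψ (F s) (ψ y))
      (frame (mapInCharts φ ψ (F s)) (frameInChart ψ e s) (ψ y))
      = Ω (F s y) (pushFrame d F e s y) := by
  rw [hF.frame_eq hφ hψ e hs hy hFy, mapInCharts_apply hy]
  exact formInChart_toChart Ω hφ hFy _

lemma update_toChart {y : M} (X : Fin n → TangentSpace (𝓡 d) y) (i : Fin n)
    (Y : TangentSpace (𝓡 d) y) :
    update (fun i ↦ toChart φ y (X i)) i (toChart φ y Y)
      = fun j ↦ toChart φ y (update X i Y j) :=
  (funext fun j ↦ apply_update (fun _ ↦ toChart φ y) X i Y j).symm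

/-- Near a point of the domain of the frame, the flow can be read in charts: there are a relatively
open piece `J ∩ T` of the time interval and an open set `W` of the chart on which this is so. -/
lemma IsMeanCurvatureFlow.exists_chart_nhds (hF : IsMeanCurvatureFlow n g J F)
    {U : Set (ℝ × N)} (hU : IsOpen U) {t : ℝ} (ht : t ∈ J) {x : N} (hx : (t, x) ∈ U)
    (hφx : F t x ∈ φ.source) (hψx : x ∈ ψ.source) :
    ∃ T : Set ℝ, IsOpen T ∧ t ∈ T ∧ ∃ W : Set (EuclideanSpace ℝ (Fin n)), IsOpen W ∧ ψ x ∈ W ∧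
      ∀ z ∈ W, ∃ y ∈ ψ.source, ψ y = z ∧ ∀ s ∈ J ∩ T, (s, y) ∈ U ∧ F s y ∈ φ.source := by
  have h1 : ∀ᶠ p in 𝓝[J ×ˢ Set.univ] (t, x), F p.1 p.2 ∈ φ.source :=
    (hF.smooth.continuousOn (t, x) ⟨ht, trivial⟩) (φ.open_source.mem_nhds hφx)
  rw [eventually_nhdsWithin_iff] at h1
  obtain ⟨T, Y, hT, htT, hY, hxY, hTY⟩ := mem_nhds_prod_iff'.1
    (Filter.inter_mem (hU.mem_nhds hx) h1)
  refine ⟨T, hT, htT, ψ.target ∩ ψ.symm ⁻¹' Y, ψ.isOpen_inter_preimage_symm hY,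
    ⟨ψ.map_source hψx, by simpa [ψ.left_inv hψx] using hxY⟩, fun z hz ↦
    ⟨ψ.symm z, ψ.map_target hz.1, ψ.right_inv hz.1, fun s hs ↦ ?_⟩⟩
  have h2 := hTY (Set.mk_mem_prod hs.2 hz.2)
  exact ⟨h2.1, h2.2 ⟨hs.1, trivial⟩⟩

end Flow

end

end MCF

/-! ### The evolution equation on the manifold -/

theorem mainTheorem3 {n m : ℕ}
    {M : Type*} [TopologicalSpace M] [ChartedSpace (EuclideanSpace ℝ (Fin (n + m))) M]
    [IsManifold (𝓡 (n + m)) ∞ M] (g : MCF.Metric (n + m) M)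
    {N : Type*} [TopologicalSpace N] [ChartedSpace (EuclideanSpace ℝ (Fin n)) N]
    [IsManifold (𝓡 n) ∞ N]
    (Ω : ∀ y : M, TangentSpace (𝓡 (n + m)) y [⋀^Fin n]→L[ℝ] ℝ)
    (hΩ : MCF.IsSmoothForm Ω) (hΩ_par : MCF.IsParallelForm g Ω)
    (J : Set ℝ) (hJ : J.OrdConnected) (hJ_nt : J.Nontrivial)
    (F : ℝ → N → M) (hF : MCF.IsMeanCurvatureFlow n g J F)
    (U : Set (ℝ × N)) (hU : IsOpen U)
    (e : Fin n → ℝ → ∀ x : N, TangentSpace (𝓡 n) x)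
    (he : MCF.IsOrthonormalFrame g J F U e)
    (t : ℝ) (ht : t ∈ J) (x : N) (hx : (t, x) ∈ U)
    (ν : Fin m → TangentSpace (𝓡 (n + m)) (F t x))
    (hν : ∀ α β, g.inner (F t x) (ν α) (ν β) = if α = β then 1 else 0)
    (hν_normal : ∀ α v, g.inner (F t x) (ν α) (mfderiv (𝓡 n) (𝓡 (n + m)) (F t) x v) = 0)
    (φ : OpenPartialHomeomorph M (EuclideanSpace ℝ (Fin (n + m))))
    (hφ : φ ∈ IsManifold.maximalAtlas (𝓡 (n + m)) ∞ M) (hφx : F t x ∈ φ.source)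
    (ψ : OpenPartialHomeomorph N (EuclideanSpace ℝ (Fin n)))
    (hψ : ψ ∈ IsManifold.maximalAtlas (𝓡 n) ∞ N) (hψx : x ∈ ψ.source) :
    let E : Fin n → TangentSpace (𝓡 (n + m)) (F t x) := MCF.pushFrame (n + m) F e t x
    let u : ℝ → N → ℝ := fun s y ↦ Ω (F s y) (MCF.pushFrame (n + m) F e s y)
    let h : Fin m → Fin n → Fin n → ℝ := fun α i k ↦
      MCF.secondFund g φ ψ (F t) x (e i t x) (e k t x) (ν α)
    HasDerivWithinAt (fun s ↦ u s x)
      (MCF.laplacian g φ ψ (F t) (u t) x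
        + u t x * ∑ α, ∑ i, ∑ k, h α i k ^ 2
        - 2 * ∑ p, ∑ q with p < q, ∑ α, ∑ β, ∑ k,
            Ω (F t x) (Function.update (Function.update E p (ν α)) q (ν β)) * h α p k * h β q k
        - ∑ i, ∑ α, ∑ k,
            Ω (F t x) (Function.update E i (ν α))
              * MCF.curvature g φ (F t x) (ν α) (E k) (E k) (E i))
      J t := by
  intro E u h
  obtain ⟨T, hT, htT, W, hW, hxW, hTW⟩ := hF.exists_chart_nhds hU ht hx hφx hψx
  have htJ : t ∈ J ∩ T := ⟨ht, htT⟩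
  set G := MCF.metricInChart g φ with hG
  set η := MCF.formInChart Ω φ with hη_def
  set f : ℝ → EuclideanSpace ℝ (Fin n) → EuclideanSpace ℝ (Fin (n + m)) :=
    fun s ↦ MCF.mapInCharts φ ψ (F s) with hf_def
  have hη : MCF.IsParallelOn G φ.target η := MCF.isParallelOn_formInChart hΩ_par hφ
  have hηd : ∀ p ∈ φ.target, DifferentiableAt ℝ η p := fun p hp ↦
    ((hΩ φ hφ).contDiffAt (φ.open_target.mem_nhds hp)).differentiableAt (by simp)
  have hS : ∀ p ∈ (J ∩ T) ×ˢ W, p.1 ∈ J ∧ p.2 ∈ ψ.target ∧ F p.1 (ψ.symm p.2) ∈ φ.source ∧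
      (p.1, ψ.symm p.2) ∈ U := by
    rintro ⟨s, z⟩ ⟨hs, hz⟩
    obtain ⟨y, hy, rfl, hsy⟩ := hTW z hz
    simp only [ψ.left_inv hy]
    exact ⟨hs.1, ψ.map_source hy, (hsy s hs).2, (hsy s hs).1⟩
  have hfS : ContDiffOn ℝ ∞ (fun p : ℝ × EuclideanSpace ℝ (Fin n) ↦ f p.1 p.2) ((J ∩ T) ×ˢ W) :=
    MCF.contDiffOn_mapInCharts hφ hψ hF.smooth fun p hp ↦
      ⟨(hS p hp).1, (hS p hp).2.1, (hS p hp).2.2.1⟩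
  have heS : ∀ i, ContDiffOn ℝ ∞ (fun p : ℝ × EuclideanSpace ℝ (Fin n) ↦
      MCF.frameInChart ψ e p.1 i p.2) ((J ∩ T) ×ˢ W) := fun i ↦
    MCF.contDiffOn_toChart hψ (he.smooth i) fun p hp ↦
      ⟨(hS p hp).1, (hS p hp).2.1, (hS p hp).2.2.2⟩
  have hslice : ContDiffOn ℝ ∞ (fun z : EuclideanSpace ℝ (Fin n) ↦ (t, z)) W :=
    (contDiff_prodMk_right t).contDiffOn
  have hf : MCF.FramedImmersion G φ.target (f t) W (MCF.frameInChart ψ e t) :=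
    { riemannian := MCF.isRiemannianOn_metricInChart g hφ
      isOpen := hW
      contDiffOn := hfS.comp hslice fun z hz ↦ ⟨htJ, hz⟩
      mapsTo := fun z hz ↦ φ.map_source (hS (t, z) ⟨htJ, hz⟩).2.2.1
      injective := fun z hz ↦ by
        obtain ⟨y, hy, rfl, hsy⟩ := hTW z hz
        have hFy := (hsy t htJ).2
        have hsurj : Function.Surjective (MCF.toChart ψ y) :=
          (MCF.mdifferentiable_chart hψ).mfderiv_surjective hy
        rw [injective_iff_map_eq_zero]
        intro v hv
        obtain ⟨v, rfl⟩ := hsurj v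
        have hv' := (hF.fderiv_mapInCharts hφ hψ ht hy hFy v).symm.trans hv
        have h1 : mfderiv (𝓡 n) (𝓡 (n + m)) (F t) y v = 0 :=
          MCF.toChart_injective hφ hFy (hv'.trans (map_zero (MCF.toChart φ (F t y))).symm)
        have h2 : v = 0 := hF.immersion t ht y
          (h1.trans (map_zero (mfderiv (𝓡 n) (𝓡 (n + m)) (F t) y)).symm)
        rw [h2, map_zero]
      contDiffOn_frame := fun i ↦ (heS i).comp hslice fun z hz ↦ ⟨htJ, hz⟩
      orthonormal := fun z hz ↦ by
        obtain ⟨y, hy, rfl, hsy⟩ := hTW z hz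
        exact he.inner_frame hF hφ hψ ht hy (hsy t htJ).2 (hsy t htJ).1 }
  -- The charts are valid only for times in the open set T, so the argument runs on J ∩ T, which
  -- keeps the two properties of J needed at an endpoint.
  have hJT : UniqueDiffOn ℝ (J ∩ T) := (MCF.uniqueDiffOn_of_ordConnected hJ hJ_nt).inter hT
  have hJT' : J ∩ T ⊆ closure (interior (J ∩ T)) := by
    rw [interior_inter, hT.interior_eq]
    rintro s ⟨hs, hsT⟩
    rw [Set.inter_comm]
    exact hT.inter_closure ⟨hsT, MCF.subset_closure_interior_of_ordConnected hJ hJ_nt hs⟩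
  have hvel : ∀ z ∈ W, HasDerivWithinAt (fun s ↦ f s z) (MCF.meanCurvCoord G (f t) z) (J ∩ T) t :=
    fun z hz ↦ by
      have h1 := hS (t, z) ⟨htJ, hz⟩
      have h2 := hF.velocity φ hφ ψ hψ t ht (ψ.symm z) (ψ.map_target h1.2.1) h1.2.2.1
      rw [ψ.right_inv h1.2.1] at h2
      exact h2.mono Set.inter_subset_left
  have hUx : ∀ s ∈ J ∩ T, (s, x) ∈ U ∧ F s x ∈ φ.source := fun s hs ↦ by
    have h1 := hS (s, ψ x) ⟨hs, hxW⟩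
    simp only [ψ.left_inv hψx] at h1
    exact ⟨h1.2.2.2, h1.2.2.1⟩
  have key := MCF.hasDerivWithinAt_form_of_velocity (f := f)
    (ε := fun i s ↦ MCF.frameInChart ψ e s i) htJ (hJT t htJ) hf hxW hη hηd (hvel _ hxW)
    (fun i ↦ MCF.hasDerivWithinAt_fderiv_apply hJT hJT' hW hfS
      ((heS i).differentiableOn (by simp)) htJ hxW hvel)
    (by
      filter_upwards [self_mem_nhdsWithin] with s hs
      exact he.inner_frame hF hφ hψ hs.1 hψx (hUx s hs).2 (hUx s hs).1)
  have hft : f t (ψ x) = φ (F t x) := MCF.mapInCharts_apply hψx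
  have hframe : MCF.frame (f t) (MCF.frameInChart ψ e t) (ψ x)
      = fun i ↦ MCF.toChart φ (F t x) (E i) := hF.frame_eq hφ hψ e ht hψx hφx
  have hsimons := hf.sum_cov_meanCurvCoord (ν := fun α ↦ MCF.toChart φ (F t x) (ν α)) hxW hη hηd
    (by simp)
    (fun α β ↦ by
      rw [hft]
      exact (MCF.metricInChart_toChart g hφ hφx _ _).trans (hν α β))
    (fun α i ↦ by
      rw [hft, hframe]
      exact (MCF.metricInChart_toChart g hφ hφx _ _).trans (hν_normal α _))
  have hlap : MCF.laplacianCoord (MCF.inducedMetric G (f t))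
      (fun z ↦ η (f t z) (MCF.frame (f t) (MCF.frameInChart ψ e t) z)) (ψ x)
      = MCF.laplacian g φ ψ (F t) (u t) x := by
    -- The Laplacian depends only on the germ at ψ x, so agreement of the two functions on W
    -- suffices.
    refine MCF.laplacianCoord_congr _ ?_
    filter_upwards [hW.mem_nhds hxW] with z hz
    obtain ⟨y, hy, rfl, hsy⟩ := hTW z hz
    rw [ψ.left_inv hy]
    exact hF.form_eq Ω hφ hψ e ht hy (hsy t htJ).2
  have hform : ∀ X : Fin n → TangentSpace (𝓡 (n + m)) (F t x),
      η (φ (F t x)) (fun i ↦ MCF.toChart φ (F t x) (X i)) = Ω (F t x) X :=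
    MCF.formInChart_toChart Ω hφ hφx
  have h2 := key.congr_deriv hsimons
  rw [hlap, hframe, hft] at h2
  simp only [MCF.update_toChart, hform, MCF.frameInChart_apply e t _ hψx] at h2
  have h3 : HasDerivWithinAt (fun s ↦ u s x) _ (J ∩ T) t := h2.congr
    (fun s hs ↦ (hF.form_eq Ω hφ hψ e hs.1 hψx (hUx s hs).2).symm)
    (hF.form_eq Ω hφ hψ e ht hψx hφx).symm
  -- T is a neighbourhood of t, so the derivative within J ∩ T is the derivative within J.
  exact (hasDerivWithinAt_inter (hT.mem_nhds htT)).1 h3
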